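/- **Setting.** Let $\mathscr G$ be a set of finite groups. For $L\le G\times H$ put $k_1(L)=\{g\in G: (g,1)\in L\}$, $k_2(L)=\{h\in H: (1,h)\in L\}$, and let $p_1(L)\le G$, $p_2(L)\le H$ be the images of $L$ under the projections. Let $\mathsf B$ be the category with object set $\mathscr G$ in which a morphism from $H$ to $G$ is a subgroup $L\le G\times H$, the composite of $L\le G\times H$ and $M\le H\times K$ is $$L*M=\{(g,k)\in G\times K : \exists\, h\in H,\ (g,h)\in L,\ (h,k)\in M\},$$ and the identity of $G$ is $\Delta(G)=\{(g,g):g\in G\}$. A *section* of $G$ is a pair $(P,K)$ with $K\trianglelefteq P\le G$; sections $(P_1,K_1)$ of $G$ and $(P_2,K_2)$ of $H$ are *isomorphic* if $P_1/K_1\cong P_2/K_2$. For such sections and an isomorphism $\alpha\colon P_2/K_2\to P_1/K_1$, write $$(P_1,K_1,\alpha,P_2,K_2)=\{(g,h)\in P_1\times P_2:\alpha(hK_2)=gK_1\}\le G\times H,$$ and put $e_{(P,K)}=(P,K,\mathrm{id},P,K)$. Let $\mathsf C$ be a finite (not necessarily full) subcategory of $\mathsf B$, with $\mathsf C_{G,H}=\mathrm{Hom}_{\mathsf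 C}(H,G)$, satisfying the following closure condition: whenever $Q$ is a finite group with $Q\cong p_1(L)/k_1(L)$ for some morphism $L$ of $\mathsf C$, and $(P_1,K_1)$, $(P_2,K_2)$ are sections of objects $G$, $H$ of $\mathsf C$ with $P_1/K_1\cong Q\cong P_2/K_2$, there is an isomorphism $\alpha\colon P_2/K_2\to P_1/K_1$ with $(P_1,K_1,\alpha,P_2,K_2)\in\mathsf C_{G,H}$. Let $R$ be a commutative ring in which $|G|$ is invertible for every object $G$ of $\mathsf C$. Let $A=A^\kappa_{\mathsf C,R}$ be the twisted category algebra: the free $R$-module on the morphisms of $\mathsf C$, with $L\cdot M=\kappa(L,M)\,L*M$, $\kappa(L,M)=|k_2(L)\cap k_1(M)|/|H|$ for $L\in\mathsf C_{G,H}$, $M\in\mathsf C_{H,K}$, and with $L\cdot M=0$ if $L$ and $M$ are not composable. For a section $(P,K)$ of an object $G$ of $\mathsf C$ with $e=e_{(P,K)}\in\mathsf C_{G,G}$, let $\mathrm{Aut}_{\mathsf C}(P/K)$ be the group of all $\alpha\in\mathrm{Aut}(P/K)$ with $(P,K,\alpha,P,K)\in\mathsf C_{G,G}$, and let $e'=e'_{(P,K)}=[G:K]\,e$,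 an idempotent of $A$. Let $\Gamma_e$ be the group of invertible elements of the monoid $e*\mathsf C_{G,G}*e$ and $J_e$ its complement in that monoid. Then $e'Ae'=R_\kappa\Gamma_e\oplus RJ_e$, where $RJ_e$ is an ideal and $R_\kappa\Gamma_e$ is a subalgebra isomorphic to $R\,\mathrm{Aut}_{\mathsf C}(P/K)$ via $\alpha\mapsto[G:K]\,(P,K,\alpha,P,K)$. For an $R\,\mathrm{Aut}_{\mathsf C}(P/K)$-module $T$, let $\mathrm{Inf}(T)$ be the $e'Ae'$-module obtained from $T$ through the projection $e'Ae'\to R_\kappa\Gamma_e\cong R\,\mathrm{Aut}_{\mathsf C}(P/K)$ with kernel $RJ_e$. The head of a module $M$ is $\mathrm{Hd}(M)=M/\mathrm{Rad}(M)$, where $\mathrm{Rad}(M)$ is the intersection of all maximal submodules of $M$. **Theorem.** Let $\mathcal S$ be a set of representatives of the isomorphism classes of sections $(P,K)$ of objects $G$ of $\mathsf C$ with $e_{(P,K)}\in\mathsf C_{G,G}$, and for each $(P,K)\in\mathcal S$ let $\mathcal T_{(P,K)}$ be a set of representatives of the isomorphism classes of simple left $R\,\mathrm{Aut}_{\mathsf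 C}(P/K)$-modules. Then for all $(P,K)\in\mathcal S$ and $T\in\mathcal T_{(P,K)}$ the $A$-module $$\mathrm{Hd}\bigl(Ae'_{(P,K)}\otimes_{e'_{(P,K)}Ae'_{(P,K)}}\mathrm{Inf}(T)\bigr)$$ is simple, and sending $((P,K),T)$ to its isomorphism class defines a bijection from the set of pairs $((P,K),T)$ with $(P,K)\in\mathcal S$, $T\in\mathcal T_{(P,K)}$ onto the set of isomorphism classes of simple left $A$-modules. -/

import Mathlib

open CategoryTheory
open scoped TensorProduct

universe u v w

namespace BisetAlg

set_option linter.unusedSectionVars false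

/-! ### Twisted category algebras -/

section TwistedAlgebra

/-- The set of all morphisms of a category. -/
@[ext]
structure Mor (C : Type u) [Category.{v} C] where
  dom : C
  cod : C
  hom : dom ⟶ cod

theorem Mor.hom_inj {C : Type u} [Category.{v} C] {X Y : C} {f g : X ⟶ Y}
    (h : (⟨X, Y, f⟩ : Mor C) = ⟨X, Y, g⟩) : f = g := by
  simpa using h

/-- A `2`-cocycle of the category `C` with values in the unit group of `R`:
`α(u ∘ t, s) α(u, t) = α(u, t ∘ s) α(t, s)`.  (Recall that `s ≫ t` is `t ∘ s`.) -/
structure TwoCocycle (R : Type w) [CommRing R] (C : Type u) [Category.{v} C] where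
  val : ∀ {X Y Z : C}, (Y ⟶ Z) → (X ⟶ Y) → Rˣ
  cocycle : ∀ {W X Y Z : C} (s : W ⟶ X) (t : X ⟶ Y) (u : Y ⟶ Z),
    val (t ≫ u) s * val u t = val u (s ≫ t) * val t s

/-- The twisted category algebra `R_α C`: the free `R`-module on the set of morphisms. -/
def TwistedCategoryAlgebra {R : Type w} [CommRing R] {C : Type u} [Category.{v} C]
    (_α : TwoCocycle R C) : Type (max u v w) :=
  Mor C →₀ R

namespace TwistedCategoryAlgebra

variable {R : Type w} [CommRing R] {C : Type u} [Category.{v} C] (α : TwoCocycle R C)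

noncomputable instance : AddCommGroup (TwistedCategoryAlgebra α) :=
  inferInstanceAs (AddCommGroup (Mor C →₀ R))

noncomputable instance : Module R (TwistedCategoryAlgebra α) :=
  inferInstanceAs (Module R (Mor C →₀ R))

/-- The `R`-basis of `R_α C` consisting of the morphisms of `C`. -/
noncomputable def basis : Module.Basis (Mor C) R (TwistedCategoryAlgebra α) :=
  Module.Basis.ofRepr (LinearEquiv.refl R (Mor C →₀ R))

/-- The basis element given by a morphism. -/
noncomputable def of (m : Mor C) : TwistedCategoryAlgebra α := basis α m

open scoped Classical in
/-- The product of two basis elements: `t · s = α(t, s) (t ∘ s)` if `t ∘ s` exists,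
and `t · s = 0` otherwise. -/
noncomputable def basisMul (t s : Mor C) : TwistedCategoryAlgebra α :=
  if h : s.cod = t.dom then
    (α.val t.hom (s.hom ≫ eqToHom h) : R) • of α ⟨s.dom, t.cod, (s.hom ≫ eqToHom h) ≫ t.hom⟩
  else 0

/-- The `R`-bilinear extension of `basisMul`. -/
noncomputable def mulLin :
    TwistedCategoryAlgebra α →ₗ[R] TwistedCategoryAlgebra α →ₗ[R] TwistedCategoryAlgebra α :=
  (basis α).constr R fun t => (basis α).constr R fun s => basisMul α t s

noncomputable instance : Mul (TwistedCategoryAlgebra α) := ⟨fun a b => mulLin α a b⟩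

theorem mul_def (a b : TwistedCategoryAlgebra α) : a * b = mulLin α a b := rfl

theorem of_mul_of (t s : Mor C) : of α t * of α s = basisMul α t s := by
  simp [mul_def, mulLin, of, Module.Basis.constr_basis]

theorem of_mul_of_comp {X Y Z : C} (t : Y ⟶ Z) (s : X ⟶ Y) :
    of α ⟨Y, Z, t⟩ * of α ⟨X, Y, s⟩ = (α.val t s : R) • of α ⟨X, Z, s ≫ t⟩ := by
  rw [of_mul_of]
  simp [basisMul]

theorem of_mul_of_ne {t s : Mor C} (h : s.cod ≠ t.dom) : of α t * of α s = 0 := by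
  rw [of_mul_of]
  simp [basisMul, h]

theorem induction_of {p : TwistedCategoryAlgebra α → Prop} (h0 : p 0)
    (hadd : ∀ a b, p a → p b → p (a + b)) (hsmul : ∀ (r : R) a, p a → p (r • a))
    (hof : ∀ m, p (of α m)) (a : TwistedCategoryAlgebra α) : p a := by
  have ha : a ∈ Submodule.span R (Set.range (basis α)) := by
    rw [(basis α).span_eq]; trivial
  induction ha using Submodule.span_induction with
  | mem x hx => obtain ⟨m, rfl⟩ := hx; exact hof m
  | zero => exact h0
  | add x y _ _ hx hy => exact hadd x y hx hy
  | smul r x _ hx => exact hsmul r x hx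

theorem tadd_mul (a b c : TwistedCategoryAlgebra α) : (a + b) * c = a * c + b * c := by
  simp [mul_def]

theorem tmul_add (a b c : TwistedCategoryAlgebra α) : a * (b + c) = a * b + a * c := by
  simp [mul_def]

theorem tzero_mul (a : TwistedCategoryAlgebra α) : 0 * a = 0 := by simp [mul_def]

theorem tmul_zero (a : TwistedCategoryAlgebra α) : a * 0 = 0 := by simp [mul_def]

theorem smul_mul (r : R) (a b : TwistedCategoryAlgebra α) : (r • a) * b = r • (a * b) := by
  simp [mul_def]

theorem mul_smul' (r : R) (a b : TwistedCategoryAlgebra α) : a * (r • b) = r • (a * b) := by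
  simp [mul_def]

theorem of_assoc (u t s : Mor C) :
    of α u * of α t * of α s = of α u * (of α t * of α s) := by
  obtain ⟨Y, Z, u⟩ := u
  obtain ⟨X, Y', t⟩ := t
  obtain ⟨W, X', s⟩ := s
  by_cases h1 : Y' = Y
  · subst h1
    by_cases h2 : X' = X
    · subst h2
      have h := congrArg (fun x : Rˣ => (x : R)) (α.cocycle s t u)
      simp only [Units.val_mul] at h
      simp only [of_mul_of_comp, smul_mul, mul_smul', smul_smul, Category.assoc]
      congr 1
      rw [mul_comm, h, mul_comm]
    · rw [of_mul_of_comp, smul_mul, of_mul_of_ne α (t := ⟨X, Y', t⟩) h2,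
        of_mul_of_ne α (t := ⟨X, Z, t ≫ u⟩) h2]
      simp [mul_def]
  · by_cases h2 : X' = X
    · subst h2
      rw [of_mul_of_comp, mul_smul', of_mul_of_ne α (s := ⟨X', Y', t⟩) h1,
        of_mul_of_ne α (s := ⟨W, Y', s ≫ t⟩) h1]
      simp [mul_def]
    · rw [of_mul_of_ne α (s := ⟨X, Y', t⟩) h1, of_mul_of_ne α (t := ⟨X, Y', t⟩) h2]
      simp [mul_def]

theorem assoc' (a b c : TwistedCategoryAlgebra α) : a * b * c = a * (b * c) := by
  induction a using induction_of with
  | h0 => simp only [tzero_mul]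
  | hadd x y hx hy => simp only [tadd_mul, hx, hy]
  | hsmul r x hx => simp only [smul_mul, hx]
  | hof u =>
    induction b using induction_of with
    | h0 => simp only [tzero_mul, tmul_zero]
    | hadd x y hx hy => simp only [tadd_mul, tmul_add, hx, hy]
    | hsmul r x hx => simp only [smul_mul, mul_smul', hx]
    | hof t =>
      induction c using induction_of with
      | h0 => simp only [tmul_zero]
      | hadd x y hx hy => simp only [tmul_add, hx, hy]
      | hsmul r x hx => simp only [mul_smul', hx]
      | hof s => exact of_assoc α u t s

theorem val_id_right {X Y : C} (t : X ⟶ Y) : α.val t (𝟙 X) = α.val (𝟙 X) (𝟙 X) := by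
  have h := α.cocycle (𝟙 X) (𝟙 X) t
  simp only [Category.id_comp] at h
  exact mul_left_cancel h

theorem val_id_left {X Y : C} (s : X ⟶ Y) : α.val (𝟙 Y) s = α.val (𝟙 Y) (𝟙 Y) := by
  have h := α.cocycle s (𝟙 Y) (𝟙 Y)
  simp only [Category.comp_id] at h
  exact (mul_right_cancel ((mul_comm _ _).trans h)).symm

theorem finite_obj (C : Type u) [Category.{v} C] [Finite (Mor C)] : Finite C :=
  Finite.of_injective (fun X : C => (⟨X, X, 𝟙 X⟩ : Mor C))
    fun _ _ h => congrArg Mor.dom h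

variable [Finite (Mor C)]

/-- If `C` is finite then `∑ α(id, id)⁻¹ id` is an identity element of `R_α C`. -/
noncomputable instance : One (TwistedCategoryAlgebra α) :=
  ⟨∑ᶠ X : C, ((α.val (𝟙 X) (𝟙 X))⁻¹ : Rˣ).val • of α ⟨X, X, 𝟙 X⟩⟩

theorem one_def : (1 : TwistedCategoryAlgebra α) =
    ∑ᶠ X : C, ((α.val (𝟙 X) (𝟙 X))⁻¹ : Rˣ).val • of α ⟨X, X, 𝟙 X⟩ := rfl

theorem one_mul' (a : TwistedCategoryAlgebra α) : 1 * a = a := by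
  classical
  have := finite_obj C
  have := Fintype.ofFinite C
  induction a using induction_of with
  | h0 => simp only [tmul_zero]
  | hadd x y hx hy => simp only [tmul_add, hx, hy]
  | hsmul r x hx => simp only [mul_smul', hx]
  | hof s =>
    obtain ⟨X, Y, s⟩ := s
    rw [one_def, finsum_eq_sum_of_fintype, mul_def, map_sum, LinearMap.sum_apply,
      Finset.sum_eq_single Y]
    · rw [← mul_def, smul_mul, of_mul_of_comp, smul_smul, val_id_left α s]
      simp
    · intro Z _ hZ
      rw [← mul_def, smul_mul, of_mul_of_ne α (fun h => hZ h.symm), smul_zero]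
    · simp

theorem mul_one' (a : TwistedCategoryAlgebra α) : a * 1 = a := by
  classical
  have := finite_obj C
  have := Fintype.ofFinite C
  induction a using induction_of with
  | h0 => simp only [tzero_mul]
  | hadd x y hx hy => simp only [tadd_mul, hx, hy]
  | hsmul r x hx => simp only [smul_mul, hx]
  | hof s =>
    obtain ⟨X, Y, s⟩ := s
    rw [one_def, finsum_eq_sum_of_fintype, mul_def, map_sum, Finset.sum_eq_single X]
    · rw [← mul_def, mul_smul', of_mul_of_comp, smul_smul, val_id_right α s]
      simp
    · intro Z _ hZ
      rw [← mul_def, mul_smul', of_mul_of_ne α (fun h => hZ h), smul_zero]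
    · simp

noncomputable instance : Ring (TwistedCategoryAlgebra α) where
  __ := (inferInstance : AddCommGroup (TwistedCategoryAlgebra α))
  mul := (· * ·)
  one := 1
  left_distrib := tmul_add α
  right_distrib := tadd_mul α
  zero_mul := tzero_mul α
  mul_zero := tmul_zero α
  mul_assoc := assoc' α
  one_mul := one_mul' α
  mul_one := mul_one' α

noncomputable instance : Algebra R (TwistedCategoryAlgebra α) :=
  Algebra.ofModule (smul_mul α) (mul_smul' α)

end TwistedCategoryAlgebra

end TwistedAlgebra

/-! ### Condensation: `A e ⊗_{eAe} W`, heads, classes of simple modules -/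

section Condensation

variable {A : Type u} [Ring A]

/-- The left `A`-module `A e`. -/
abbrev leftIdeal (e : A) : Submodule A A := Submodule.span A {e}

/-- The right action of `e A e` on `A e` by multiplication. -/
instance cornerRightModule {e : A} (he : IsIdempotentElem e) :
    Module (he.Corner)ᵐᵒᵖ (leftIdeal e) where
  smul b x := ⟨x.1 * b.unop.1, by
    obtain ⟨a, ha⟩ := b.unop.2
    rw [Submodule.mem_span_singleton]
    exact ⟨x.1 * e * a, by rw [← ha]; simp only [smul_eq_mul, mul_assoc]⟩⟩
  one_smul x := Subtype.ext <| by
    obtain ⟨a, ha⟩ := Submodule.mem_span_singleton.mp x.2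
    change x.1 * e = x.1
    rw [← ha, smul_eq_mul, mul_assoc, he.eq]
  mul_smul b c x := Subtype.ext (mul_assoc x.1 c.unop.1 b.unop.1).symm
  smul_zero b := Subtype.ext (zero_mul b.unop.1)
  smul_add b x y := Subtype.ext (add_mul x.1 y.1 b.unop.1)
  add_smul b c x := Subtype.ext (mul_add x.1 b.unop.1 c.unop.1)
  zero_smul x := Subtype.ext (mul_zero x.1)

theorem corner_smul_coe {e : A} (he : IsIdempotentElem e) (b : (he.Corner)ᵐᵒᵖ)
    (x : leftIdeal e) : ((b • x : leftIdeal e) : A) = x.1 * b.unop.1 := rfl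

instance cornerSMulComm {e : A} (he : IsIdempotentElem e) :
    SMulCommClass A (he.Corner)ᵐᵒᵖ (leftIdeal e) where
  smul_comm a b x := Subtype.ext (mul_assoc a x.1 b.unop.1).symm

/-- The `A`-submodule of `X ⊗_ℤ W` generated by the elements `x b ⊗ w - x ⊗ b w`, for an
`(A, B)`-bimodule `X` and a left `B`-module `W`. -/
def balancedRel (A B X W : Type*) [Ring A] [Ring B] [AddCommGroup X] [Module A X]
    [Module Bᵐᵒᵖ X] [AddCommGroup W] [Module B W] :
    Submodule A (X ⊗[ℤ] W) :=
  Submodule.span A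
    {z | ∃ (x : X) (b : B) (w : W), z = (MulOpposite.op b • x) ⊗ₜ[ℤ] w - x ⊗ₜ[ℤ] (b • w)}

/-- The tensor product `X ⊗_B W` of an `(A, B)`-bimodule `X` with a left `B`-module `W`,
where `A` and `B` are not necessarily commutative rings; it is a left `A`-module. -/
abbrev BimoduleTensor (A B X W : Type*) [Ring A] [Ring B] [AddCommGroup X] [Module A X]
    [Module Bᵐᵒᵖ X] [SMulCommClass A Bᵐᵒᵖ X] [AddCommGroup W] [Module B W] : Type _ :=
  (X ⊗[ℤ] W) ⧸ balancedRel A B X W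

/-- The `A`-module `A e ⊗_{eAe} W`. -/
abbrev inducedModule {e : A} (he : IsIdempotentElem e) (W : Type v) [AddCommGroup W]
    [Module he.Corner W] : Type (max u v) :=
  BimoduleTensor A he.Corner (leftIdeal e) W

/-- The head `M / Rad(M)`, where `Rad(M)` is the intersection of all maximal submodules. -/
abbrev head (A : Type u) [Ring A] (M : Type v) [AddCommGroup M] [Module A M] : Type v :=
  M ⧸ Module.jacobson A M

/-- Isomorphism of simple left `A`-modules. -/
def simpleSetoid (A : Type u) [Ring A] :
    Setoid {M : ModuleCat.{v} A // IsSimpleModule A M} where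
  r M N := Nonempty (M.1 ≃ₗ[A] N.1)
  iseqv := ⟨fun _ => ⟨LinearEquiv.refl A _⟩, fun ⟨f⟩ => ⟨f.symm⟩, fun ⟨f⟩ ⟨g⟩ => ⟨f.trans g⟩⟩

/-- The set of isomorphism classes of simple left `A`-modules. -/
def SimpleClasses (A : Type u) [Ring A] : Type (max u (v + 1)) :=
  Quotient (simpleSetoid.{u, v} A)

/-- `X` is a set of representatives of the isomorphism classes of simple left `A`-modules. -/
def IsSimpleRepresentatives (A : Type u) [Ring A] (X : Set (ModuleCat.{v} A)) : Prop :=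
  (∀ T ∈ X, IsSimpleModule A T) ∧
    ∀ M : ModuleCat.{v} A, IsSimpleModule A M → ∃! T, T ∈ X ∧ Nonempty (M ≃ₗ[A] T)

end Condensation

/-! ### Sections of groups and subgroups of direct products -/

section Groups

variable {G H K J : Type u} [Group G] [Group H] [Group K] [Group J]

/-- A section `(P, K)` of `G`: subgroups `P = top` and `K = bot` of `G` with `K` normal in `P`. -/
@[ext]
structure GroupSection (G : Type u) [Group G] where
  top : Subgroup G
  bot : Subgroup G
  le : bot ≤ top
  normal : (bot.subgroupOf top).Normal

attribute [instance] GroupSection.normal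

/-- The subquotient `P / K` of a section `(P, K)`. -/
abbrev GroupSection.quot (s : GroupSection G) : Type u := s.top ⧸ s.bot.subgroupOf s.top

/-- The coset `g K` for `g ∈ P`. -/
abbrev GroupSection.coset (s : GroupSection G) (g : G) (hg : g ∈ s.top) : s.quot :=
  QuotientGroup.mk (⟨g, hg⟩ : s.top)

theorem GroupSection.coset_surj (s : GroupSection G) (x : s.quot) : ∃ g hg, s.coset g hg = x := by
  obtain ⟨⟨g, hg⟩, rfl⟩ := QuotientGroup.mk_surjective x
  exact ⟨g, hg, rfl⟩

theorem GroupSection.coset_eq_one (s : GroupSection G) {g : G} (hg : g ∈ s.top) :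
    s.coset g hg = 1 ↔ g ∈ s.bot := by
  rw [GroupSection.coset, QuotientGroup.eq_one_iff, Subgroup.mem_subgroupOf]

/-- `p₁(L)` -/
abbrev p₁ (L : Subgroup (G × H)) : Subgroup G := L.map (MonoidHom.fst G H)

/-- `p₂(L)` -/
abbrev p₂ (L : Subgroup (G × H)) : Subgroup H := L.map (MonoidHom.snd G H)

/-- `k₁(L) = {g | (g, 1) ∈ L}` -/
abbrev k₁ (L : Subgroup (G × H)) : Subgroup G := L.comap (MonoidHom.inl G H)

/-- `k₂(L) = {h | (1, h) ∈ L}` -/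
abbrev k₂ (L : Subgroup (G × H)) : Subgroup H := L.comap (MonoidHom.inr G H)

theorem mem_p₁ {L : Subgroup (G × H)} {g : G} : g ∈ p₁ L ↔ ∃ h, (g, h) ∈ L := by
  simp [Subgroup.mem_map]

theorem mem_p₂ {L : Subgroup (G × H)} {h : H} : h ∈ p₂ L ↔ ∃ g, (g, h) ∈ L := by
  simp [Subgroup.mem_map]

theorem mem_k₁ {L : Subgroup (G × H)} {g : G} : g ∈ k₁ L ↔ (g, 1) ∈ L := Iff.rfl

theorem mem_k₂ {L : Subgroup (G × H)} {h : H} : h ∈ k₂ L ↔ (1, h) ∈ L := Iff.rfl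

/-- The section `(p₁(L), k₁(L))`. -/
def leftSection (L : Subgroup (G × H)) : GroupSection G where
  top := p₁ L
  bot := k₁ L
  le g hg := mem_p₁.mpr ⟨1, hg⟩
  normal := ⟨by
    rintro ⟨n, hn'⟩ hn ⟨g, hg⟩
    obtain ⟨h, hgh⟩ := mem_p₁.mp hg
    rw [Subgroup.mem_subgroupOf] at hn ⊢
    have := mul_mem (mul_mem hgh (mem_k₁.mp hn)) (inv_mem hgh)
    simpa [mem_k₁] using this⟩

/-- The section `(p₂(L), k₂(L))`. -/
def rightSection (L : Subgroup (G × H)) : GroupSection H where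
  top := p₂ L
  bot := k₂ L
  le g hg := mem_p₂.mpr ⟨1, hg⟩
  normal := ⟨by
    rintro ⟨n, hn'⟩ hn ⟨g, hg⟩
    obtain ⟨h, hgh⟩ := mem_p₂.mp hg
    rw [Subgroup.mem_subgroupOf] at hn ⊢
    have := mul_mem (mul_mem hgh (mem_k₂.mp hn)) (inv_mem hgh)
    simpa [mem_k₂] using this⟩

/-- The subgroup of `G × H` with quintuple `(P₁, K₁, φ, P₂, K₂)`, i.e.
`{(g, h) ∈ P₁ × P₂ | φ (h K₂) = g K₁}`. -/
def quintuple (s : GroupSection G) (t : GroupSection H) (φ : t.quot ≃* s.quot) :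
    Subgroup (G × H) where
  carrier := {x | ∃ (h₁ : x.1 ∈ s.top) (h₂ : x.2 ∈ t.top), φ (t.coset x.2 h₂) = s.coset x.1 h₁}
  mul_mem' := by
    rintro x y ⟨hx₁, hx₂, hx⟩ ⟨hy₁, hy₂, hy⟩
    refine ⟨mul_mem hx₁ hy₁, mul_mem hx₂ hy₂, ?_⟩
    change φ (t.coset x.2 hx₂ * t.coset y.2 hy₂) = s.coset x.1 hx₁ * s.coset y.1 hy₁
    rw [map_mul, hx, hy]
  one_mem' := ⟨one_mem _, one_mem _, map_one φ⟩
  inv_mem' := by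
    rintro x ⟨hx₁, hx₂, hx⟩
    refine ⟨inv_mem hx₁, inv_mem hx₂, ?_⟩
    change φ (t.coset x.2 hx₂)⁻¹ = (s.coset x.1 hx₁)⁻¹
    rw [map_inv, hx]

theorem mem_quintuple {s : GroupSection G} {t : GroupSection H} {φ : t.quot ≃* s.quot}
    {x : G × H} : x ∈ quintuple s t φ ↔
      ∃ (h₁ : x.1 ∈ s.top) (h₂ : x.2 ∈ t.top), φ (t.coset x.2 h₂) = s.coset x.1 h₁ := Iff.rfl

theorem leftSection_quintuple (s : GroupSection G) (t : GroupSection H)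
    (φ : t.quot ≃* s.quot) : leftSection (quintuple s t φ) = s := by
  ext g
  · change g ∈ p₁ _ ↔ _
    rw [mem_p₁]
    constructor
    · rintro ⟨h, h₁, -, -⟩; exact h₁
    · intro hg
      obtain ⟨h, hh, e⟩ := t.coset_surj (φ.symm (s.coset g hg))
      exact ⟨h, hg, hh, by rw [e]; simp⟩
  · change g ∈ k₁ _ ↔ _
    rw [mem_k₁, mem_quintuple]
    have h1 : t.coset (1 : H) (one_mem _) = 1 := (t.coset_eq_one _).mpr (one_mem _)
    constructor
    · rintro ⟨h₁, h₂, e⟩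
      refine (s.coset_eq_one h₁).mp ?_
      rw [← e, h1, map_one]
    · intro hg
      refine ⟨s.le hg, one_mem _, ?_⟩
      rw [(s.coset_eq_one _).mpr hg, h1, map_one]

theorem rightSection_quintuple (s : GroupSection G) (t : GroupSection H)
    (φ : t.quot ≃* s.quot) : rightSection (quintuple s t φ) = t := by
  ext g
  · change g ∈ p₂ _ ↔ _
    rw [mem_p₂]
    constructor
    · rintro ⟨h, -, h₂, -⟩; exact h₂
    · intro hg
      obtain ⟨h, hh, e⟩ := s.coset_surj (φ (t.coset g hg))
      exact ⟨h, hh, hg, e.symm⟩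
  · change g ∈ k₂ _ ↔ _
    rw [mem_k₂, mem_quintuple]
    have h1 : s.coset (1 : G) (one_mem _) = 1 := (s.coset_eq_one _).mpr (one_mem _)
    constructor
    · rintro ⟨h₁, h₂, e⟩
      refine (t.coset_eq_one h₂).mp (φ.injective ?_)
      rw [e, h1, map_one]
    · intro hg
      refine ⟨one_mem _, t.le hg, ?_⟩
      rw [(t.coset_eq_one _).mpr hg, h1, map_one]

theorem quintuple_injective (s : GroupSection G) (t : GroupSection H) :
    Function.Injective (quintuple s t) := by
  intro φ ψ h
  ext x
  obtain ⟨b, hb, rfl⟩ := t.coset_surj x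
  obtain ⟨a, ha, e⟩ := s.coset_surj (φ (t.coset b hb))
  have hm : (a, b) ∈ quintuple s t ψ := h ▸ (⟨ha, hb, e.symm⟩ : (a, b) ∈ quintuple s t φ)
  obtain ⟨_, _, e'⟩ := hm
  rw [← e, e']

/-- Every subgroup of `G × H` is given by a quintuple. -/
theorem exists_eq_quintuple (L : Subgroup (G × H)) :
    ∃ φ : (rightSection L).quot ≃* (leftSection L).quot,
      L = quintuple (leftSection L) (rightSection L) φ := by
  let f₁ : L →* (leftSection L).quot := (QuotientGroup.mk' _).comp
    (((MonoidHom.fst G H).comp L.subtype).codRestrict (leftSection L).top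
      fun x => mem_p₁.mpr ⟨x.1.2, x.2⟩)
  let f₂ : L →* (rightSection L).quot := (QuotientGroup.mk' _).comp
    (((MonoidHom.snd G H).comp L.subtype).codRestrict (rightSection L).top
      fun x => mem_p₂.mpr ⟨x.1.1, x.2⟩)
  have e₁ : ∀ x : L, f₁ x = (leftSection L).coset x.1.1 (mem_p₁.mpr ⟨x.1.2, x.2⟩) := fun _ => rfl
  have e₂ : ∀ x : L, f₂ x = (rightSection L).coset x.1.2 (mem_p₂.mpr ⟨x.1.1, x.2⟩) := fun _ => rfl
  have s₁ : Function.Surjective f₁ := fun x => by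
    obtain ⟨g, hg, rfl⟩ := (leftSection L).coset_surj x
    obtain ⟨h, hh⟩ := mem_p₁.mp hg
    exact ⟨⟨(g, h), hh⟩, rfl⟩
  have s₂ : Function.Surjective f₂ := fun x => by
    obtain ⟨g, hg, rfl⟩ := (rightSection L).coset_surj x
    obtain ⟨h, hh⟩ := mem_p₂.mp hg
    exact ⟨⟨(h, g), hh⟩, rfl⟩
  have hk : f₂.ker = f₁.ker := by
    ext ⟨⟨g, h⟩, hx⟩
    rw [MonoidHom.mem_ker, MonoidHom.mem_ker, e₁, e₂]
    refine Iff.trans ((rightSection L).coset_eq_one _)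
      (Iff.trans ?_ ((leftSection L).coset_eq_one _).symm)
    change (1, h) ∈ L ↔ (g, 1) ∈ L
    constructor
    · intro h'
      simpa using mul_mem hx (inv_mem h')
    · intro h'
      simpa using mul_mem (inv_mem h') hx
  let φ : (rightSection L).quot ≃* (leftSection L).quot :=
    ((QuotientGroup.quotientKerEquivOfSurjective f₂ s₂).symm.trans
      (QuotientGroup.quotientMulEquivOfEq hk)).trans
      (QuotientGroup.quotientKerEquivOfSurjective f₁ s₁)
  have hφ : ∀ x : L, φ (f₂ x) = f₁ x := by
    intro x
    have : (QuotientGroup.quotientKerEquivOfSurjective f₂ s₂).symm (f₂ x) =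
        (QuotientGroup.mk x : L ⧸ f₂.ker) := by
      rw [MulEquiv.symm_apply_eq]; rfl
    simp only [φ, MulEquiv.trans_apply, this]
    rfl
  refine ⟨φ, ?_⟩
  ext ⟨g, h⟩
  rw [mem_quintuple]
  constructor
  · intro hx
    exact ⟨mem_p₁.mpr ⟨h, hx⟩, mem_p₂.mpr ⟨g, hx⟩, hφ ⟨(g, h), hx⟩⟩
  · rintro ⟨h₁, h₂, e⟩
    obtain ⟨g', hg'⟩ := mem_p₂.mp h₂
    have h3 := hφ ⟨(g', h), hg'⟩
    rw [e₁, e₂] at h3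
    have h4 := h3.symm.trans e
    rw [QuotientGroup.eq, Subgroup.mem_subgroupOf] at h4
    have h5 : (g'⁻¹ * g, (1 : H)) ∈ L := h4
    simpa using mul_mem hg' h5

/-- `L * M = {(g, k) | ∃ h, (g, h) ∈ L ∧ (h, k) ∈ M}` -/
def star (L : Subgroup (G × H)) (M : Subgroup (H × K)) : Subgroup (G × K) where
  carrier := {x | ∃ h : H, (x.1, h) ∈ L ∧ (h, x.2) ∈ M}
  mul_mem' := by
    rintro x y ⟨a, ha₁, ha₂⟩ ⟨b, hb₁, hb₂⟩
    exact ⟨a * b, mul_mem ha₁ hb₁, mul_mem ha₂ hb₂⟩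
  one_mem' := ⟨1, one_mem L, one_mem M⟩
  inv_mem' := by
    rintro x ⟨a, ha₁, ha₂⟩
    exact ⟨a⁻¹, inv_mem ha₁, inv_mem ha₂⟩

theorem mem_star {L : Subgroup (G × H)} {M : Subgroup (H × K)} {x : G × K} :
    x ∈ star L M ↔ ∃ h : H, (x.1, h) ∈ L ∧ (h, x.2) ∈ M := Iff.rfl

theorem star_assoc (L : Subgroup (G × H)) (M : Subgroup (H × K)) (N : Subgroup (K × J)) :
    star (star L M) N = star L (star M N) := by
  ext ⟨g, j⟩
  simp only [mem_star]
  constructor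
  · rintro ⟨k, ⟨h, h1, h2⟩, h3⟩; exact ⟨h, h1, k, h2, h3⟩
  · rintro ⟨h, h1, k, h2, h3⟩; exact ⟨k, ⟨h, h1, h2⟩, h3⟩

/-- `Δ(G) = {(g, g) | g ∈ G}` -/
def diag (G : Type u) [Group G] : Subgroup (G × G) where
  carrier := {x | x.1 = x.2}
  mul_mem' := by
    intro x y hx hy
    exact congrArg₂ (· * ·) hx hy
  one_mem' := rfl
  inv_mem' := by
    intro x hx
    exact congrArg (·⁻¹) hx

theorem mem_diag {x : G × G} : x ∈ diag G ↔ x.1 = x.2 := Iff.rfl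

theorem diag_star (L : Subgroup (G × H)) : star (diag G) L = L := by
  ext ⟨g, h⟩
  simp [mem_star, mem_diag]

theorem star_diag (L : Subgroup (G × H)) : star L (diag H) = L := by
  ext ⟨g, h⟩
  simp [mem_star, mem_diag]

theorem quintuple_star_quintuple (s : GroupSection G) (t : GroupSection H) (r : GroupSection K)
    (φ : t.quot ≃* s.quot) (ψ : r.quot ≃* t.quot) :
    star (quintuple s t φ) (quintuple t r ψ) = quintuple s r (ψ.trans φ) := by
  ext ⟨g, k⟩
  simp only [mem_star, mem_quintuple]
  constructor
  · rintro ⟨h, ⟨h1, h2, h3⟩, ⟨h4, h5, h6⟩⟩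
    exact ⟨h1, h5, by rw [MulEquiv.trans_apply, h6, h3]⟩
  · rintro ⟨h1, h2, h3⟩
    obtain ⟨h, hh, e⟩ := t.coset_surj (ψ (r.coset k h2))
    exact ⟨h, ⟨h1, hh, by rw [e]; exact h3⟩, ⟨hh, h2, e.symm⟩⟩

/-- `e_{(P, K)} = (P, K, id, P, K)` -/
def GroupSection.idem (s : GroupSection G) : Subgroup (G × G) :=
  quintuple s s (MulEquiv.refl _)

theorem p₁_star_le (L : Subgroup (G × H)) (M : Subgroup (H × K)) : p₁ (star L M) ≤ p₁ L := by
  intro g hg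
  obtain ⟨k, h, h1, h2⟩ := mem_p₁.mp hg
  exact mem_p₁.mpr ⟨h, h1⟩

theorem p₂_star_le (L : Subgroup (G × H)) (M : Subgroup (H × K)) : p₂ (star L M) ≤ p₂ M := by
  intro g hg
  obtain ⟨k, h, h1, h2⟩ := mem_p₂.mp hg
  exact mem_p₂.mpr ⟨h, h2⟩

theorem k₁_le_star (L : Subgroup (G × H)) (M : Subgroup (H × K)) : k₁ L ≤ k₁ (star L M) :=
  fun _ hg => ⟨1, hg, one_mem M⟩

theorem k₂_le_star (L : Subgroup (G × H)) (M : Subgroup (H × K)) : k₂ M ≤ k₂ (star L M) :=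
  fun _ hg => ⟨1, one_mem L, hg⟩

theorem section_eq_of_le [Finite G] {s t : GroupSection G} (h1 : t.top ≤ s.top)
    (h2 : s.bot ≤ t.bot) (h : Nat.card s.quot = Nat.card t.quot) : t = s := by
  have hs := Subgroup.card_eq_card_quotient_mul_card_subgroup (s.bot.subgroupOf s.top)
  have ht := Subgroup.card_eq_card_quotient_mul_card_subgroup (t.bot.subgroupOf t.top)
  rw [Nat.card_congr (Subgroup.subgroupOfEquivOfLe s.le).toEquiv] at hs
  rw [Nat.card_congr (Subgroup.subgroupOfEquivOfLe t.le).toEquiv] at ht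
  have h3 := Subgroup.card_le_of_le h1
  have h4 := Subgroup.card_le_of_le h2
  have hq : 0 < Nat.card t.quot := Nat.card_pos
  change Nat.card s.top = Nat.card s.quot * _ at hs
  change Nat.card t.top = Nat.card t.quot * _ at ht
  rw [h] at hs
  have h5 : Nat.card t.bot = Nat.card s.bot := by
    refine le_antisymm ?_ h4
    exact Nat.le_of_mul_le_mul_left (by rw [← hs, ← ht]; exact h3) hq
  have h6 : Nat.card s.top = Nat.card t.top := by rw [hs, ht, h5]
  ext1
  · exact Subgroup.eq_of_le_of_card_ge h1 h6.le
  · exact (Subgroup.eq_of_le_of_card_ge h2 h5.le).symm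

/-- If `L` and `M` lie between `e = e_{(P, K)}` and `L * M = (P, K, γ, P, K)`, then both `L`
and `M` are of this form. -/
theorem eq_quintuple_of_star_eq [Finite G] (s : GroupSection G) (L M : Subgroup (G × G))
    (hL : star s.idem (star L s.idem) = L) (hM : star s.idem (star M s.idem) = M)
    (γ : s.quot ≃* s.quot) (h : star L M = quintuple s s γ) :
    (∃ α, L = quintuple s s α) ∧ ∃ β, M = quintuple s s β := by
  have hi1 : p₁ s.idem = s.top := congrArg GroupSection.top (leftSection_quintuple s s _)
  have hi2 : p₂ s.idem = s.top := congrArg GroupSection.top (rightSection_quintuple s s _)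
  have hi3 : k₁ s.idem = s.bot := congrArg GroupSection.bot (leftSection_quintuple s s _)
  have hi4 : k₂ s.idem = s.bot := congrArg GroupSection.bot (rightSection_quintuple s s _)
  have hg1 : p₁ (star L M) = s.top := by
    rw [h]; exact congrArg GroupSection.top (leftSection_quintuple s s _)
  have hg2 : p₂ (star L M) = s.top := by
    rw [h]; exact congrArg GroupSection.top (rightSection_quintuple s s _)
  have hg3 : k₁ (star L M) = s.bot := by
    rw [h]; exact congrArg GroupSection.bot (leftSection_quintuple s s _)
  have hg4 : k₂ (star L M) = s.bot := by
    rw [h]; exact congrArg GroupSection.bot (rightSection_quintuple s s _)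
  have bd : ∀ N : Subgroup (G × G), star s.idem (star N s.idem) = N →
      p₁ N ≤ s.top ∧ s.bot ≤ k₁ N ∧ p₂ N ≤ s.top ∧ s.bot ≤ k₂ N := by
    intro N hN
    refine ⟨?_, ?_, ?_, ?_⟩
    · rw [← hN, ← hi1]; exact p₁_star_le _ _
    · rw [← hN, ← hi3]; exact k₁_le_star _ _
    · rw [← hN, ← star_assoc, ← hi2]; exact p₂_star_le _ _
    · rw [← hN, ← star_assoc, ← hi4]; exact k₂_le_star _ _
  obtain ⟨a1, a2, a3, a4⟩ := bd L hL
  obtain ⟨b1, b2, b3, b4⟩ := bd M hM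
  have l1 : leftSection L = s := by
    ext1
    · exact le_antisymm a1 (hg1 ▸ p₁_star_le L M)
    · exact le_antisymm (hg3 ▸ k₁_le_star L M) a2
  have r1 : rightSection M = s := by
    ext1
    · exact le_antisymm b3 (hg2 ▸ p₂_star_le L M)
    · exact le_antisymm (hg4 ▸ k₂_le_star L M) b4
  obtain ⟨α, hα⟩ := exists_eq_quintuple L
  obtain ⟨β, hβ⟩ := exists_eq_quintuple M
  have l2 : rightSection L = s := by
    refine section_eq_of_le a3 a4 ?_
    rw [← l1]
    exact (Nat.card_congr α.toEquiv).symm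
  have r2 : leftSection M = s := by
    refine section_eq_of_le b1 b2 ?_
    rw [← r1]
    exact (Nat.card_congr β.toEquiv)
  constructor
  · clear hβ β
    generalize leftSection L = x at *
    generalize rightSection L = y at *
    subst l1; subst l2
    exact ⟨α, hα⟩
  · clear hα α
    generalize leftSection M = x at *
    generalize rightSection M = y at *
    subst r1; subst r2
    exact ⟨β, hβ⟩

/-- The numerators in the definition of `κ` satisfy the cocycle identity. -/
theorem card_cocycle (L : Subgroup (G × H)) (M : Subgroup (H × K)) (N : Subgroup (K × J)) :
    Nat.card ↥(k₂ (star L M) ⊓ k₁ N) * Nat.card ↥(k₂ L ⊓ k₁ M) =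
      Nat.card ↥(k₂ L ⊓ k₁ (star M N)) * Nat.card ↥(k₂ M ⊓ k₁ N) := by
  let X : Subgroup (H × K) := M ⊓ (k₂ L).prod (k₁ N)
  have key : ∀ {Y : Type u} [Group Y] (f : X →* Y),
      Nat.card f.range * Nat.card f.ker = Nat.card X := by
    intro Y _ f
    rw [Subgroup.card_eq_card_quotient_mul_card_subgroup f.ker,
      Nat.card_congr (QuotientGroup.quotientKerEquivRange f).toEquiv]
  let f₂ : X →* K := (MonoidHom.snd H K).comp X.subtype
  let f₁ : X →* H := (MonoidHom.fst H K).comp X.subtype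
  have r₂ : f₂.range = k₂ (star L M) ⊓ k₁ N := by
    ext k
    constructor
    · rintro ⟨⟨⟨h, k⟩, hM, hL, hN⟩, rfl⟩
      exact ⟨⟨h, hL, hM⟩, hN⟩
    · rintro ⟨⟨h, hL, hM⟩, hN⟩
      exact ⟨⟨⟨h, k⟩, hM, hL, hN⟩, rfl⟩
  have r₁ : f₁.range = k₂ L ⊓ k₁ (star M N) := by
    ext h
    constructor
    · rintro ⟨⟨⟨h, k⟩, hM, hL, hN⟩, rfl⟩
      exact ⟨hL, ⟨k, hM, hN⟩⟩
    · rintro ⟨hL, ⟨k, hM, hN⟩⟩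
      exact ⟨⟨⟨h, k⟩, hM, hL, hN⟩, rfl⟩
  have c₂ : Nat.card f₂.ker = Nat.card ↥(k₂ L ⊓ k₁ M) := by
    refine Nat.card_congr
      { toFun := fun x => ⟨x.1.1.1, x.1.2.2.1, ?_⟩
        invFun := fun h => ⟨⟨(h.1, 1), h.2.2, h.2.1, one_mem (k₁ N)⟩, rfl⟩
        left_inv := ?_
        right_inv := fun _ => rfl }
    · have h1 : x.1.1.2 = 1 := x.2
      have h2 := x.1.2.1
      change (x.1.1.1, 1) ∈ M
      rw [← h1]; exact h2
    · rintro ⟨⟨⟨h, k⟩, hx⟩, hk⟩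
      have : k = 1 := hk
      subst this
      rfl
  have c₁ : Nat.card f₁.ker = Nat.card ↥(k₂ M ⊓ k₁ N) := by
    refine Nat.card_congr
      { toFun := fun x => ⟨x.1.1.2, ?_, x.1.2.2.2⟩
        invFun := fun k => ⟨⟨(1, k.1), k.2.1, one_mem (k₂ L), k.2.2⟩, rfl⟩
        left_inv := ?_
        right_inv := fun _ => rfl }
    · have h1 : x.1.1.1 = 1 := x.2
      have h2 := x.1.2.1
      change (1, x.1.1.2) ∈ M
      rw [← h1]; exact h2
    · rintro ⟨⟨⟨h, k⟩, hx⟩, hk⟩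
      have : h = 1 := hk
      subst this
      rfl
  rw [← r₂, ← c₂, ← r₁, ← c₁, key, key]

end Groups

/-! ### Subcategories of the biset-type category -/

section Subcategory

variable {ι : Type u} {𝒢 : ι → Type u} [∀ i, Group (𝒢 i)] [∀ i, Finite (𝒢 i)]

/-- A subcategory of the category `B` whose objects are the finite groups of the family `𝒢`,
whose morphisms from `H` to `G` are the subgroups of `G × H`, whose composition is
`L ∘ M = L * M` and whose identities are the `Δ(G)`.  `hom i j` is the set `C_{G, H}` of
morphisms from `H = 𝒢 j` to `G = 𝒢 i`; it is empty if one of `i`, `j` is not an object. -/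
structure BisetSubcategory (𝒢 : ι → Type u) [∀ i, Group (𝒢 i)] where
  obj : Set ι
  hom : ∀ i j : ι, Set (Subgroup (𝒢 i × 𝒢 j))
  obj_of_hom : ∀ {i j : ι} {L : Subgroup (𝒢 i × 𝒢 j)}, L ∈ hom i j → i ∈ obj ∧ j ∈ obj
  id_mem : ∀ i ∈ obj, diag (𝒢 i) ∈ hom i i
  comp_mem : ∀ {i j k : ι} {L : Subgroup (𝒢 i × 𝒢 j)} {M : Subgroup (𝒢 j × 𝒢 k)},
    L ∈ hom i j → M ∈ hom j k → star L M ∈ hom i k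

namespace BisetSubcategory

/-- The type of objects of `C`. -/
def Obj (C : BisetSubcategory 𝒢) : Type u := {i : ι // i ∈ C.obj}

/-- `C` as a category.  (`M ≫ L` is `L ∘ M = L * M`.) -/
instance (C : BisetSubcategory 𝒢) : SmallCategory C.Obj where
  Hom j i := {L : Subgroup (𝒢 i.1 × 𝒢 j.1) // L ∈ C.hom i.1 j.1}
  id i := ⟨diag _, C.id_mem i.1 i.2⟩
  comp M L := ⟨star L.1 M.1, C.comp_mem L.2 M.2⟩
  id_comp M := Subtype.ext (star_diag M.1)
  comp_id M := Subtype.ext (diag_star M.1)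
  assoc N M L := Subtype.ext (star_assoc L.1 M.1 N.1).symm

theorem comp_val {C : BisetSubcategory 𝒢} {k j i : C.Obj} (M : k ⟶ j) (L : j ⟶ i) :
    (M ≫ L).1 = star L.1 M.1 := rfl

variable (C : BisetSubcategory 𝒢)

/-- The finite group `Q` is realized by a morphism in `C`. -/
def Realizes (Q : Type u) [Group Q] : Prop :=
  ∃ (i j : ι) (L : Subgroup (𝒢 i × 𝒢 j)), L ∈ C.hom i j ∧
    Nonempty ((leftSection L).quot ≃* Q)

/-- The closure condition on `C`: if `Q` is realized in `C` and `(P₁, K₁)`, `(P₂, K₂)` are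
sections of objects `G`, `H` of `C` with `P₁ / K₁ ≅ Q ≅ P₂ / K₂` then
`(P₁, K₁, α, P₂, K₂) ∈ C_{G, H}` for some isomorphism `α : P₂ / K₂ → P₁ / K₁`. -/
def IsClosed : Prop :=
  ∀ (Q : Type u) [Group Q] [Finite Q], C.Realizes Q →
    ∀ i ∈ C.obj, ∀ j ∈ C.obj, ∀ (s : GroupSection (𝒢 i)) (t : GroupSection (𝒢 j)),
      Nonempty (s.quot ≃* Q) → Nonempty (Q ≃* t.quot) →
        ∃ φ : t.quot ≃* s.quot, quintuple s t φ ∈ C.hom i j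

/-- The order of every object of `C` is invertible in `R`. -/
def OrdersInvertible (R : Type u) [CommRing R] : Prop :=
  ∀ i ∈ C.obj, IsUnit (Nat.card (𝒢 i) : R)

variable {R : Type u} [CommRing R]

/-- The order of a subgroup of a finite group, as a unit of `R`. -/
noncomputable def cardUnit {G : Type u} [Group G] (h : IsUnit (Nat.card G : R))
    (U : Subgroup G) : Rˣ :=
  (isUnit_of_dvd_unit (Nat.cast_dvd_cast (Subgroup.card_subgroup_dvd_card U)) h).unit

theorem cardUnit_val {G : Type u} [Group G] (h : IsUnit (Nat.card G : R))
    (U : Subgroup G) : (cardUnit h U : R) = (Nat.card U : R) := rfl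

variable {C}

/-- The `2`-cocycle `κ(L, M) = |k₂(L) ∩ k₁(M)| / |H|` for `L ∈ C_{G, H}`, `M ∈ C_{H, K}`. -/
noncomputable def kappa (hR : C.OrdersInvertible R) : TwoCocycle R C.Obj where
  val {_ j _} L M := cardUnit (hR j.1 j.2) (k₂ L.1 ⊓ k₁ M.1) / (hR j.1 j.2).unit
  cocycle {l k j i} N M L := by
    have h := congrArg (fun n : ℕ => (n : R)) (card_cocycle L.1 M.1 N.1)
    simp only [Nat.cast_mul] at h
    rw [div_mul_div_comm, div_mul_div_comm, mul_comm (IsUnit.unit (hR k.1 k.2))]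
    congr 1
    exact Units.ext h

/-- The twisted category algebra `A = A^κ_{C, R}`. -/
abbrev TwistedAlgebra (hR : C.OrdersInvertible R) : Type u :=
  TwistedCategoryAlgebra (kappa hR)

variable (C)

/-- The sections `(P, K)` of objects `G` of `C` with `e_{(P, K)} ∈ C_{G, G}`. -/
structure IdemSection where
  obj : C.Obj
  sec : GroupSection (𝒢 obj.1)
  idem_mem : sec.idem ∈ C.hom obj.1 obj.1

variable {C}

namespace IdemSection

/-- Isomorphism of sections: `P₁ / K₁ ≅ P₂ / K₂`. -/
def Iso (s t : C.IdemSection) : Prop := Nonempty (s.sec.quot ≃* t.sec.quot)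

variable (s : C.IdemSection)

/-- `Aut_C(P/K) = {α ∈ Aut(P/K) | (P, K, α, P, K) ∈ C_{G, G}}`; multiplication is composition. -/
def autGroup : Subgroup (MulAut s.sec.quot) :=
  have hmul : ∀ {α β : MulAut s.sec.quot},
      quintuple s.sec s.sec α ∈ C.hom s.obj.1 s.obj.1 →
      quintuple s.sec s.sec β ∈ C.hom s.obj.1 s.obj.1 →
      quintuple s.sec s.sec (α * β) ∈ C.hom s.obj.1 s.obj.1 := fun {α β} hα hβ => by
    have := C.comp_mem hα hβ
    rwa [quintuple_star_quintuple] at this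
  { carrier := {α | quintuple s.sec s.sec α ∈ C.hom s.obj.1 s.obj.1}
    mul_mem' := hmul
    one_mem' := s.idem_mem
    inv_mem' := fun {α} hα => by
      have hpow : ∀ n : ℕ, quintuple s.sec s.sec (α ^ n) ∈ C.hom s.obj.1 s.obj.1 := by
        intro n
        induction n with
        | zero => exact s.idem_mem
        | succ n ih => rw [pow_succ]; exact hmul ih hα
      obtain ⟨n, hn⟩ := (isOfFinOrder_of_finite α).mem_powers_iff_mem_zpowers.mpr
        (inv_mem (Subgroup.mem_zpowers α))
      change quintuple s.sec s.sec α⁻¹ ∈ C.hom s.obj.1 s.obj.1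
      rw [← hn]
      exact hpow n }

/-- The morphism `(P, K, α, P, K)`, for `α ∈ Aut_C(P/K)`. -/
def autMor (α : s.autGroup) : s.obj ⟶ s.obj := ⟨quintuple s.sec s.sec α.1, α.2⟩

/-- The idempotent morphism `e = e_{(P, K)}`. -/
def idemMor : s.obj ⟶ s.obj := ⟨s.sec.idem, s.idem_mem⟩

/-- The group `Γ_e` of invertible elements of the monoid `e ∘ End_C(G) ∘ e`. -/
def unitMor : Set (s.obj ⟶ s.obj) :=
  {L | s.idemMor ≫ L ≫ s.idemMor = L ∧ ∃ M : s.obj ⟶ s.obj,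
    s.idemMor ≫ M ≫ s.idemMor = M ∧ L ≫ M = s.idemMor ∧ M ≫ L = s.idemMor}

/-- `J_e`, the complement of `Γ_e` in `e ∘ End_C(G) ∘ e`. -/
def nonunitMor : Set (s.obj ⟶ s.obj) :=
  {L | s.idemMor ≫ L ≫ s.idemMor = L ∧ L ∉ s.unitMor}

theorem autMor_injective : Function.Injective s.autMor := fun _ _ h =>
  Subtype.ext (quintuple_injective _ _ (congrArg Subtype.val h))

theorem autMor_comp (α β : s.autGroup) : s.autMor β ≫ s.autMor α = s.autMor (α * β) :=
  Subtype.ext (quintuple_star_quintuple _ _ _ _ _)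

theorem autMor_one : s.autMor 1 = s.idemMor := rfl

theorem autMor_mem (α : s.autGroup) : s.autMor α ∈ s.unitMor := by
  have h : ∀ β, s.idemMor ≫ s.autMor β ≫ s.idemMor = s.autMor β := fun β => by
    rw [← autMor_one, autMor_comp, autMor_comp]; simp
  refine ⟨h α, s.autMor α⁻¹, h _, ?_, ?_⟩ <;> rw [autMor_comp, ← autMor_one] <;> simp

theorem idem_comp : s.idemMor ≫ s.idemMor = s.idemMor := by
  rw [← autMor_one, autMor_comp, mul_one]

theorem exists_autMor {L : s.obj ⟶ s.obj} {α : MulAut s.sec.quot}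
    (h : L.1 = quintuple s.sec s.sec α) : ∃ α', L = s.autMor α' :=
  ⟨⟨α, show quintuple s.sec s.sec α ∈ _ from h ▸ L.2⟩, Subtype.ext h⟩

theorem exists_autMor_of_comp {L M : s.obj ⟶ s.obj} (hL : s.idemMor ≫ L ≫ s.idemMor = L)
    (hM : s.idemMor ≫ M ≫ s.idemMor = M) {γ : s.autGroup} (h : M ≫ L = s.autMor γ) :
    (∃ α, L = s.autMor α) ∧ ∃ β, M = s.autMor β := by
  have tr : ∀ {N : s.obj ⟶ s.obj}, s.idemMor ≫ N ≫ s.idemMor = N →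
      star s.sec.idem (star N.1 s.sec.idem) = N.1 := fun {N} hN => by
    rw [← star_assoc]
    exact congrArg Subtype.val hN
  obtain ⟨⟨α, hα⟩, β, hβ⟩ := eq_quintuple_of_star_eq s.sec L.1 M.1 (tr hL) (tr hM) γ.1
    (congrArg Subtype.val h)
  exact ⟨s.exists_autMor hα, s.exists_autMor hβ⟩

theorem card_eq_index : (Nat.card (𝒢 s.obj.1) : R) =
    (s.sec.bot.index : R) * (Nat.card s.sec.bot : R) := by
  rw [← Subgroup.index_mul_card s.sec.bot, Nat.cast_mul]

theorem isUnit_index (hR : C.OrdersInvertible R) : IsUnit (s.sec.bot.index : R) :=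
  isUnit_of_dvd_unit (Nat.cast_dvd_cast s.sec.bot.index_dvd_card) (hR s.obj.1 s.obj.2)

variable (hR : C.OrdersInvertible R)

/-- The index `[G : K]` as a unit of `R`. -/
noncomputable def indexUnit : Rˣ := (s.isUnit_index hR).unit

/-- `κ` is constant on `Γ_e` with value `[G : K]⁻¹`. -/
theorem kappa_autMor (α β : s.autGroup) :
    (kappa hR).val (s.autMor α) (s.autMor β) = (s.indexUnit hR)⁻¹ := by
  have h1 : k₂ (s.autMor α).1 = s.sec.bot :=
    congrArg GroupSection.bot (rightSection_quintuple s.sec s.sec α.1)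
  have h2 : k₁ (s.autMor β).1 = s.sec.bot :=
    congrArg GroupSection.bot (leftSection_quintuple s.sec s.sec β.1)
  have h3 : (Nat.card ↥(k₂ (s.autMor α).1 ⊓ k₁ (s.autMor β).1) : R) = Nat.card s.sec.bot := by
    rw [h1, h2, inf_idem]
  rw [eq_inv_iff_mul_eq_one]
  change cardUnit (hR s.obj.1 s.obj.2) _ / (hR s.obj.1 s.obj.2).unit * _ = 1
  rw [div_mul_eq_mul_div, div_eq_one]
  apply Units.ext
  rw [Units.val_mul, cardUnit_val, h3, mul_comm]
  exact s.card_eq_index.symm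

variable [Finite (Mor C.Obj)]

/-- `e' = e'_{(P, K)} = [G : K] e_{(P, K)}` -/
noncomputable def idemElt : TwistedAlgebra hR :=
  (s.sec.bot.index : R) • TwistedCategoryAlgebra.of (kappa hR) ⟨s.obj, s.obj, s.idemMor⟩

open TwistedCategoryAlgebra in
theorem isIdempotentElem : IsIdempotentElem (s.idemElt hR) := by
  unfold IsIdempotentElem idemElt
  rw [smul_mul, mul_smul', of_mul_of_comp, idem_comp, smul_smul, smul_smul, ← autMor_one,
    kappa_autMor]
  congr 1
  have h : (s.sec.bot.index : R) = s.indexUnit hR := rfl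
  rw [h]
  simp

/-- The ring `e' A e'`. -/
abbrev cornerRing : Type u := (s.isIdempotentElem hR).Corner

open scoped Classical in
/-- The `R`-linear map `A → R Aut_C(P/K)` with `(P, K, α, P, K) ↦ [G : K]⁻¹ α` for
`α ∈ Aut_C(P/K)`, sending all the other morphisms to `0`. -/
noncomputable def projLin : TwistedAlgebra hR →ₗ[R] MonoidAlgebra R s.autGroup :=
  (TwistedCategoryAlgebra.basis (kappa hR)).constr R fun m =>
    if h : ∃ α : s.autGroup, m = ⟨s.obj, s.obj, s.autMor α⟩ then
      MonoidAlgebra.single h.choose ((s.indexUnit hR)⁻¹ : Rˣ).val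
    else 0

open TwistedCategoryAlgebra

theorem projLin_autMor (α : s.autGroup) :
    s.projLin hR (of (kappa hR) ⟨s.obj, s.obj, s.autMor α⟩) =
      MonoidAlgebra.single α ((s.indexUnit hR)⁻¹ : Rˣ).val := by
  have h : ∃ β : s.autGroup, (⟨s.obj, s.obj, s.autMor α⟩ : Mor C.Obj) =
      ⟨s.obj, s.obj, s.autMor β⟩ := ⟨α, rfl⟩
  have h' : h.choose = α := (s.autMor_injective (Mor.hom_inj h.choose_spec)).symm
  rw [projLin, of, Module.Basis.constr_basis, dif_pos h, h']

theorem projLin_of_ne {L : s.obj ⟶ s.obj} (hL : ∀ α, L ≠ s.autMor α) :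
    s.projLin hR (of (kappa hR) ⟨s.obj, s.obj, L⟩) = 0 := by
  rw [projLin, of, Module.Basis.constr_basis, dif_neg]
  rintro ⟨α, h⟩
  exact hL α (Mor.hom_inj h)

theorem projLin_mul_of {L M : s.obj ⟶ s.obj} (hL : s.idemMor ≫ L ≫ s.idemMor = L)
    (hM : s.idemMor ≫ M ≫ s.idemMor = M) :
    s.projLin hR (of (kappa hR) ⟨s.obj, s.obj, L⟩ * of (kappa hR) ⟨s.obj, s.obj, M⟩) =
      s.projLin hR (of (kappa hR) ⟨s.obj, s.obj, L⟩) *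
        s.projLin hR (of (kappa hR) ⟨s.obj, s.obj, M⟩) := by
  rw [of_mul_of_comp, map_smul]
  by_cases h : (∃ α, L = s.autMor α) ∧ ∃ β, M = s.autMor β
  · obtain ⟨⟨α, rfl⟩, β, rfl⟩ := h
    rw [autMor_comp, projLin_autMor, projLin_autMor, projLin_autMor, kappa_autMor,
      MonoidAlgebra.single_mul_single, MonoidAlgebra.smul_single, smul_eq_mul]
  · have h1 : ∀ γ, M ≫ L ≠ s.autMor γ := fun γ hγ => h (s.exists_autMor_of_comp hL hM hγ)
    rw [s.projLin_of_ne hR h1, smul_zero]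
    by_cases hl : ∃ α, L = s.autMor α
    · have hm : ∀ β, M ≠ s.autMor β := fun β hβ => h ⟨hl, β, hβ⟩
      rw [s.projLin_of_ne hR hm, mul_zero]
    · rw [s.projLin_of_ne hR (fun α hα => hl ⟨α, hα⟩), zero_mul]

theorem corner_of (m : Mor C.Obj) : ∃ (r : R) (L : s.obj ⟶ s.obj),
    s.idemMor ≫ L ≫ s.idemMor = L ∧
    s.idemElt hR * of (kappa hR) m * s.idemElt hR =
      r • of (kappa hR) ⟨s.obj, s.obj, L⟩ := by
  obtain ⟨X, Y, f⟩ := m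
  by_cases h : X = s.obj ∧ Y = s.obj
  · obtain ⟨rfl, rfl⟩ := h
    obtain ⟨r, hr⟩ : ∃ r : R,
        s.idemElt hR * of (kappa hR) ⟨s.obj, s.obj, f⟩ * s.idemElt hR =
          r • of (kappa hR) ⟨s.obj, s.obj, s.idemMor ≫ f ≫ s.idemMor⟩ := by
      simp only [idemElt, smul_mul, mul_smul', of_mul_of_comp, smul_smul]
      exact ⟨_, rfl⟩
    refine ⟨r, s.idemMor ≫ f ≫ s.idemMor, ?_, hr⟩
    simp only [Category.assoc, idem_comp]
    rw [← Category.assoc, idem_comp]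
  · refine ⟨0, s.idemMor, by rw [idem_comp, idem_comp], ?_⟩
    simp only [idemElt, smul_mul, mul_smul', zero_smul]
    by_cases hY : Y = s.obj
    · subst hY
      rw [of_mul_of_comp, smul_mul, of_mul_of_ne _ (fun hX => h ⟨hX.symm, rfl⟩)]
      simp
    · rw [of_mul_of_ne _ hY]
      simp

theorem projLin_mul (a b : TwistedAlgebra hR) :
    s.projLin hR ((s.idemElt hR * a * s.idemElt hR) * (s.idemElt hR * b * s.idemElt hR)) =
      s.projLin hR (s.idemElt hR * a * s.idemElt hR) *
        s.projLin hR (s.idemElt hR * b * s.idemElt hR) := by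
  induction a using induction_of with
  | h0 => simp
  | hadd x y hx hy => simp only [mul_add, add_mul, map_add, hx, hy]
  | hsmul r x hx => simp only [mul_smul_comm, smul_mul_assoc, map_smul, hx]
  | hof m =>
    induction b using induction_of with
    | h0 => simp
    | hadd x y hx hy => simp only [mul_add, add_mul, map_add, hx, hy]
    | hsmul r x hx => simp only [mul_smul_comm, smul_mul_assoc, map_smul, hx]
    | hof n =>
      obtain ⟨r, L, hL, h1⟩ := s.corner_of hR m
      obtain ⟨r', M, hM, h2⟩ := s.corner_of hR n
      rw [h1, h2]
      simp only [mul_smul_comm, smul_mul_assoc, map_smul, s.projLin_mul_of hR hL hM]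

theorem projLin_idemElt : s.projLin hR (s.idemElt hR) = 1 := by
  rw [idemElt, map_smul, ← autMor_one, projLin_autMor, MonoidAlgebra.smul_single,
    MonoidAlgebra.one_def]
  congr 1
  exact (s.indexUnit hR).mul_inv

/-- The projection `e' A e' = R_κ Γ_e ⊕ R J_e → R_κ Γ_e ≅ R Aut_C(P/K)`, where the first map is
the ring homomorphism with kernel the ideal `R J_e`, and the second one is the inverse of the
isomorphism `α ↦ [G : K] (P, K, α, P, K)`. -/
noncomputable def proj : s.cornerRing hR →+* MonoidAlgebra R s.autGroup where
  toFun x := s.projLin hR x.1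
  map_one' := s.projLin_idemElt hR
  map_mul' x y := by
    obtain ⟨_, a, rfl⟩ := x
    obtain ⟨_, b, rfl⟩ := y
    exact s.projLin_mul hR a b
  map_zero' := map_zero _
  map_add' x y := map_add _ x.1 y.1

/-- `proj` sends `[G : K] (P, K, α, P, K)` to `α`. -/
theorem proj_autMor (α : s.autGroup) (x : s.cornerRing hR)
    (hx : x.1 = (s.sec.bot.index : R) • of (kappa hR) ⟨s.obj, s.obj, s.autMor α⟩) :
    s.proj hR x = MonoidAlgebra.single α 1 := by
  change s.projLin hR x.1 = _
  rw [hx, map_smul, projLin_autMor, MonoidAlgebra.smul_single]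
  congr 1
  exact (s.indexUnit hR).mul_inv

/-- `proj` vanishes on `R J_e`. -/
theorem proj_nonunitMor (L : s.obj ⟶ s.obj) (hL : L ∈ s.nonunitMor) (x : s.cornerRing hR)
    (hx : x.1 = of (kappa hR) ⟨s.obj, s.obj, L⟩) : s.proj hR x = 0 := by
  change s.projLin hR x.1 = _
  rw [hx, s.projLin_of_ne hR]
  rintro α rfl
  exact hL.2 (s.autMor_mem α)

/-- The `e' A e'`-module `Inf(T)`, for an `R Aut_C(P/K)`-module `T`. -/
noncomputable abbrev inflation (T : ModuleCat.{u} (MonoidAlgebra R s.autGroup)) :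
    ModuleCat.{u} (s.cornerRing hR) :=
  (ModuleCat.restrictScalars (s.proj hR)).obj T

/-- The `A`-module `Hd(A e' ⊗_{e' A e'} Inf(T))`. -/
noncomputable def headModule (T : ModuleCat.{u} (MonoidAlgebra R s.autGroup)) :
    ModuleCat.{u} (TwistedAlgebra hR) :=
  ModuleCat.of _ (head (TwistedAlgebra hR)
    (inducedModule (s.isIdempotentElem hR) (s.inflation hR T)))

end IdemSection

end BisetSubcategory

end Subcategory

end BisetAlg

namespace BisetAlg

set_option linter.unusedSectionVars false

/-! ### The functor from `A`-modules to `e A e`-modules sending `M` to `e M`. -/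

section CornerPart

variable {A : Type u} [Ring A] {e : A} (he : IsIdempotentElem e)

/-! Two ingredients combine: condensation at an idempotent, valid in any ring, and an order argument
on the subquotients `P / K`.

Condensation: for an idempotent `e` and a simple `e A e`-module `W`, the module `A e ⊗ W` has
exactly one maximal submodule (`jacobson_inducedModule`), because `e (A e ⊗ W)` is a copy of `W`
that generates everything. So its head `S` is simple, `e S ≅ W` (`nonempty_cornerPart_head`), and
`S` is the only simple module with this property (`nonempty_head_equiv`). Thus `W` and `S` determine
each other, and what remains is to decide which `e'` and which `W` account for each simple module
exactly once.

Order argument: composing morphisms can only shrink `|p₁(L) / k₁(L)|`, and equality forces equality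
of sections. Given a simple `M`, take `(P, K)` with `e' M ≠ 0` and `|P / K|` minimal. A morphism `L`
in `J_e` has a smaller left subquotient, and it factors through the idempotent of its left section,
which lies in the category by the closure condition and kills `M` by minimality. Hence `R J_e` kills
`M`, so `e' M` is inflated from a simple `R Aut_C(P/K)`-module. This gives surjectivity
(`IsClosed.exists_headModule_equiv`).

For injectivity, if `Hd(A e' ⊗ Inf(T))` is not killed by the idempotent `f'` of a section whose
quotient is no larger than `P / K`, then by simplicity some element of `e' A f' A e'` acts
nontrivially on `Inf(T)`, hence is not in `R J_e`; this forces the sections to be isomorphic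
(`iso_of_smul_headModule_ne_zero`). For a fixed section, `T` is recovered from `e' Hd(A e' ⊗ Inf(T))
≅ Inf(T)`. -/

theorem corner_mul_left (b : he.Corner) : e * b.1 = b.1 :=
  ((Subsemigroup.mem_corner_iff he).mp b.2).1

theorem corner_mul_right (b : he.Corner) : b.1 * e = b.1 :=
  ((Subsemigroup.mem_corner_iff he).mp b.2).2

/-- The element `e a e` of the corner ring `e A e`. -/
def toCorner (a : A) : he.Corner := ⟨e * a * e, a, rfl⟩

theorem toCorner_val (a : A) : (toCorner he a).1 = e * a * e := rfl

/-- The subgroup `e M = {m | e m = m}` of an `A`-module `M`. -/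
def cornerPart (_ : IsIdempotentElem e) (M : Type v) [AddCommGroup M] [Module A M] :
    AddSubgroup M where
  carrier := {m | e • m = m}
  add_mem' := by
    intro x y hx hy
    change e • (x + y) = x + y
    rw [smul_add, hx, hy]
  zero_mem' := smul_zero e
  neg_mem' := by
    intro x hx
    change e • (-x) = -x
    rw [smul_neg, hx]

variable {M : Type v} [AddCommGroup M] [Module A M]
variable {N : Type w} [AddCommGroup N] [Module A N]

theorem mem_cornerPart {m : M} : m ∈ cornerPart he M ↔ e • m = m := Iff.rfl

theorem idem_smul_mem (m : M) : e • m ∈ cornerPart he M := by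
  rw [mem_cornerPart, smul_smul, he.eq]

theorem corner_smul_mem (b : he.Corner) (m : M) : b.1 • m ∈ cornerPart he M := by
  rw [mem_cornerPart, smul_smul, corner_mul_left]

/-- `e M` is a module over `e A e`. -/
instance cornerPartModule : Module he.Corner (cornerPart he M) where
  smul b x := ⟨b.1 • x.1, corner_smul_mem he b x.1⟩
  one_smul x := Subtype.ext x.2
  mul_smul b c x := Subtype.ext (mul_smul b.1 c.1 x.1)
  smul_zero b := Subtype.ext (smul_zero b.1)
  smul_add b x y := Subtype.ext (smul_add b.1 x.1 y.1)
  add_smul b c x := Subtype.ext (add_smul b.1 c.1 x.1)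
  zero_smul x := Subtype.ext (zero_smul A x.1)

theorem cornerPart_smul_coe (b : he.Corner) (x : cornerPart he M) :
    ((b • x : cornerPart he M) : M) = b.1 • x.1 := rfl

/-- An isomorphism `M ≅ N` restricts to an isomorphism `e M ≅ e N`. -/
def cornerPartCongr (f : M ≃ₗ[A] N) : cornerPart he M ≃ₗ[he.Corner] cornerPart he N where
  toFun x := ⟨f x.1, by rw [mem_cornerPart, ← map_smul, (mem_cornerPart he).mp x.2]⟩
  invFun x := ⟨f.symm x.1, by rw [mem_cornerPart, ← map_smul, (mem_cornerPart he).mp x.2]⟩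
  map_add' x y := Subtype.ext (map_add f x.1 y.1)
  map_smul' b x := Subtype.ext (map_smul f b.1 x.1)
  left_inv x := Subtype.ext (f.symm_apply_apply x.1)
  right_inv x := Subtype.ext (f.apply_symm_apply x.1)

theorem exists_smul_eq [IsSimpleModule A M] {x : M} (hx : x ≠ 0) (y : M) : ∃ a : A, a • x = y :=
  Submodule.mem_span_singleton.mp <| by
    rw [IsSimpleModule.span_singleton_eq_top A hx]; trivial

/-- If `M` is simple then `e M` is zero or simple. -/
theorem isSimpleModule_cornerPart [IsSimpleModule A M] {x : M} (hx : e • x ≠ 0) :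
    IsSimpleModule he.Corner (cornerPart he M) := by
  have : Nontrivial (cornerPart he M) :=
    ⟨⟨⟨e • x, idem_smul_mem he x⟩, 0, fun h => hx (congrArg Subtype.val h)⟩⟩
  rw [isSimpleModule_iff_toSpanSingleton_surjective]
  refine ⟨this, fun y hy z => ?_⟩
  have hy' : y.1 ≠ 0 := fun h => hy (Subtype.ext h)
  obtain ⟨a, ha⟩ := exists_smul_eq (A := A) hy' z.1
  refine ⟨toCorner he a, Subtype.ext ?_⟩
  change (e * a * e) • y.1 = z.1
  rw [mul_smul, mul_smul, (mem_cornerPart he).mp y.2, ha, (mem_cornerPart he).mp z.2]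

end CornerPart

/-! ### The induced module `A e ⊗ W`, its unique maximal submodule and its head. -/

section Induced

variable {A : Type u} [Ring A] {e : A} (he : IsIdempotentElem e)
variable {W : Type v} [AddCommGroup W] [Module he.Corner W]
variable {N : Type w} [AddCommGroup N] [Module A N]

/-- The generator `e` of `A e`. -/
def leftIdealGen (e : A) : leftIdeal e := ⟨e, Submodule.mem_span_singleton_self e⟩

theorem leftIdeal_eq_smul_gen (x : leftIdeal e) : ∃ a : A, x = a • leftIdealGen e := by
  obtain ⟨a, ha⟩ := Submodule.mem_span_singleton.mp x.2
  exact ⟨a, Subtype.ext ha.symm⟩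

/-- The class of `x ⊗ w` in `A e ⊗ W`. -/
def indTmul (x : leftIdeal e) (w : W) : inducedModule he W :=
  Submodule.Quotient.mk (x ⊗ₜ[ℤ] w)

theorem indTmul_add (x : leftIdeal e) (v w : W) :
    indTmul he x (v + w) = indTmul he x v + indTmul he x w := by
  rw [indTmul, TensorProduct.tmul_add]; rfl

theorem smul_indTmul (a : A) (x : leftIdeal e) (w : W) :
    a • indTmul he x w = indTmul he (a • x) w := rfl

theorem indTmul_op_smul (x : leftIdeal e) (b : he.Corner) (w : W) :
    indTmul he (MulOpposite.op b • x) w = indTmul he x (b • w) :=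
  (Submodule.Quotient.eq _).mpr (Submodule.subset_span ⟨x, b, w, rfl⟩)

/-- Since `e` generates `A e`, the elements `a (e ⊗ w)` generate additively. No case for zero is
needed, as `0 = 0 (e ⊗ 0)`. -/
theorem inducedModule_induction {p : inducedModule he W → Prop}
    (hadd : ∀ x y, p x → p y → p (x + y))
    (h : ∀ (a : A) (w : W), p (a • indTmul he (leftIdealGen e) w))
    (m : inducedModule he W) : p m := by
  obtain ⟨z, rfl⟩ := Submodule.Quotient.mk_surjective _ m
  induction z using TensorProduct.induction_on with
  | zero =>
    have := h 0 0
    rwa [zero_smul] at this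
  | add x y hx hy => exact hadd _ _ hx hy
  | tmul x w =>
    obtain ⟨a, rfl⟩ := leftIdeal_eq_smul_gen x
    exact h a w

/-- The additive map `A e ⊗ W → e N`, `x ⊗ w ↦ x f(w)`, before passing to the quotient. -/
def liftAux (f : W →+ N) : leftIdeal e ⊗[ℤ] W →+ N :=
  (TensorProduct.lift (LinearMap.mk₂ ℤ (fun (x : leftIdeal e) (w : W) => x.1 • f w)
    (fun x y w => add_smul x.1 y.1 (f w))
    (fun n x w => by
      change (n • x.1) • f w = _
      rw [smul_assoc])
    (fun x v w => by rw [map_add, smul_add])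
    (fun n x w => by rw [map_zsmul, smul_comm]))).toAddMonoidHom

/-- The `A`-linear map `A e ⊗_ℤ W → N` given by an `e A e`-linear map `W → e N`. -/
def inducedLiftAux (f : W →ₗ[he.Corner] cornerPart he N) : leftIdeal e ⊗[ℤ] W →ₗ[A] N where
  toFun := liftAux ((cornerPart he N).subtype.comp f.toAddMonoidHom)
  map_add' := map_add _
  map_smul' a z := by
    induction z using TensorProduct.induction_on with
    | zero => simp
    | add x y hx hy => rw [smul_add, map_add, hx, hy, map_add, smul_add]
    | tmul x w => exact mul_smul a x.1 (f w).1

theorem inducedLiftAux_tmul (f : W →ₗ[he.Corner] cornerPart he N) (x : leftIdeal e) (w : W) :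
    inducedLiftAux he f (x ⊗ₜ w) = x.1 • (f w).1 := rfl

/-- The `A`-linear map `A e ⊗ W → N` given by an `e A e`-linear map `W → e N`. -/
def inducedLift (f : W →ₗ[he.Corner] cornerPart he N) : inducedModule he W →ₗ[A] N :=
  (balancedRel A he.Corner (leftIdeal e) W).liftQ (inducedLiftAux he f) <| by
    rw [balancedRel, Submodule.span_le]
    rintro _ ⟨x, b, w, rfl⟩
    rw [SetLike.mem_coe, LinearMap.mem_ker, map_sub, inducedLiftAux_tmul, inducedLiftAux_tmul,
      sub_eq_zero, map_smul, cornerPart_smul_coe, smul_smul]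
    rfl

/-- The additive map `A e ⊗ W → W`, `x ⊗ w ↦ (e x) w`, before passing to the quotient. -/
def retractAux : leftIdeal e ⊗[ℤ] W →+ W :=
  (TensorProduct.lift (LinearMap.mk₂ ℤ (fun (x : leftIdeal e) (w : W) => toCorner he x.1 • w)
    (fun x y w => by
      rw [← add_smul]; congr 1; apply Subtype.ext
      change e * (x.1 + y.1) * e = e * x.1 * e + e * y.1 * e
      rw [mul_add, add_mul])
    (fun n x w => by
      rw [← smul_assoc]; congr 1; apply Subtype.ext
      change e * (n • x.1) * e = (n • toCorner he x.1 : he.Corner).1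
      have : (n • toCorner he x.1 : he.Corner).1 = n • (e * x.1 * e) :=
        map_zsmul (⟨⟨Subtype.val, rfl⟩, fun _ _ => rfl⟩ : he.Corner →+ A) n _
      rw [this, mul_smul_comm, smul_mul_assoc])
    (fun x v w => smul_add _ _ _)
    (fun n x w => smul_comm _ _ _))).toAddMonoidHom

/-- The relations form an `A`-span while `retractAux` is only additive, so the induction must carry
an arbitrary multiplier `a`; only `a = 1` is used afterwards. -/
theorem retractAux_balancedRel {z : leftIdeal e ⊗[ℤ] W}
    (hz : z ∈ balancedRel A he.Corner (leftIdeal e) W) (a : A) : retractAux he (a • z) = 0 := by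
  induction hz using Submodule.span_induction generalizing a with
  | zero => simp
  | add x y _ _ hx hy => rw [smul_add, map_add, hx, hy, add_zero]
  | smul b x _ hx => rw [smul_smul]; exact hx _
  | mem x hx =>
    obtain ⟨x, b, w, rfl⟩ := hx
    rw [smul_sub, map_sub, sub_eq_zero]
    change toCorner he (a * (x.1 * b.1)) • w = toCorner he (a * x.1) • b • w
    rw [smul_smul]
    congr 1
    apply Subtype.ext
    change e * (a * (x.1 * b.1)) * e = e * (a * x.1) * e * b.1
    simp only [mul_assoc, corner_mul_left, corner_mul_right]

/-- The additive map `A e ⊗ W → W`, `x ⊗ w ↦ (e x) w`. -/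
def retract : inducedModule he W →+ W :=
  QuotientAddGroup.lift (balancedRel A he.Corner (leftIdeal e) W).toAddSubgroup (retractAux he)
    fun z hz => by
      have := retractAux_balancedRel he hz 1
      rwa [one_smul] at this

theorem retract_smul_gen (a : A) (w : W) :
    retract he (a • indTmul he (leftIdealGen e) w) = toCorner he a • w := by
  change toCorner he (a * e) • w = _
  congr 1
  apply Subtype.ext
  change e * (a * e) * e = e * a * e
  simp only [mul_assoc, he.eq]

theorem retract_gen (w : W) : retract he (indTmul he (leftIdealGen e) w) = w := by
  rw [← one_smul A (indTmul he _ w), retract_smul_gen]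
  have : toCorner he 1 = 1 := Subtype.ext (by rw [toCorner_val, mul_one, he.eq]; rfl)
  rw [this, one_smul]

theorem corner_smul_gen (b : he.Corner) (w : W) :
    b.1 • indTmul he (leftIdealGen e) w = indTmul he (leftIdealGen e) (b • w) := by
  rw [← indTmul_op_smul, smul_indTmul]
  congr 1
  apply Subtype.ext
  change b.1 * e = e * b.1
  rw [corner_mul_left, corner_mul_right]

theorem idem_smul_gen (w : W) :
    e • indTmul he (leftIdealGen e) w = indTmul he (leftIdealGen e) w := by
  rw [smul_indTmul]
  congr 1
  exact Subtype.ext he.eq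

/-- Together with `retract_gen` this identifies `e (A e ⊗ W)` with `W` through `w ↦ e ⊗ w`. -/
theorem idem_smul_eq (m : inducedModule he W) :
    e • m = indTmul he (leftIdealGen e) (retract he m) := by
  induction m using inducedModule_induction he with
  | hadd x y hx hy => rw [smul_add, map_add, hx, hy, indTmul_add]
  | h a w =>
    rw [retract_smul_gen, ← corner_smul_gen, toCorner_val, mul_smul, mul_smul, idem_smul_gen]

/-- The largest submodule of `A e ⊗ W` annihilated by `e`. -/
def indRad (W : Type v) [AddCommGroup W] [Module he.Corner W] :
    Submodule A (inducedModule he W) where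
  carrier := {m | ∀ a : A, retract he (a • m) = 0}
  add_mem' hx hy a := by rw [smul_add, map_add, hx, hy, add_zero]
  zero_mem' a := by rw [smul_zero, map_zero]
  smul_mem' b m hm a := by rw [smul_smul]; exact hm _

theorem indRad_ne_top [Nontrivial W] : indRad he W ≠ ⊤ := by
  intro h
  obtain ⟨w, hw⟩ := exists_ne (0 : W)
  have hm : indTmul he (leftIdealGen e) w ∈ indRad he W := h ▸ Submodule.mem_top
  have := hm 1
  rw [one_smul, retract_gen] at this
  exact hw this

/-- A submodule with an element outside `indRad` contains some `e ⊗ v` with `v ≠ 0`. Simplicity of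
`W` then puts every `e ⊗ w` into it, and these generate the whole module. -/
theorem le_indRad [IsSimpleModule he.Corner W] {X : Submodule A (inducedModule he W)}
    (hX : X ≠ ⊤) : X ≤ indRad he W := by
  intro m hm a
  by_contra h
  refine hX (eq_top_iff.mpr fun n _ => ?_)
  induction n using inducedModule_induction he with
  | hadd x y hx hy => exact X.add_mem (hx trivial) (hy trivial)
  | h c w =>
    refine X.smul_mem c ?_
    obtain ⟨b, rfl⟩ := exists_smul_eq (A := he.Corner) h w
    rw [← corner_smul_gen, ← idem_smul_eq]
    exact X.smul_mem _ (X.smul_mem _ (X.smul_mem _ hm))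

theorem isCoatom_indRad [IsSimpleModule he.Corner W] : IsCoatom (indRad he W) := by
  have := IsSimpleModule.nontrivial he.Corner W
  exact ⟨indRad_ne_top he, fun X hX => by_contra fun h => hX.not_ge (le_indRad he h)⟩

theorem eq_indRad_of_isCoatom [IsSimpleModule he.Corner W]
    {X : Submodule A (inducedModule he W)} (hX : IsCoatom X) : X = indRad he W :=
  ((hX.le_iff.mp (le_indRad he hX.1)).resolve_left (isCoatom_indRad he).1).symm

theorem jacobson_inducedModule [IsSimpleModule he.Corner W] :
    Module.jacobson A (inducedModule he W) = indRad he W :=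
  le_antisymm (sInf_le (isCoatom_indRad he))
    (le_sInf fun _ hX => (eq_indRad_of_isCoatom he hX).ge)

theorem isSimpleModule_head [IsSimpleModule he.Corner W] :
    IsSimpleModule A (head A (inducedModule he W)) := by
  rw [isSimpleModule_iff_isCoatom, jacobson_inducedModule he]
  exact isCoatom_indRad he

/-- `e Hd(A e ⊗ W) ≅ W` for simple `W`. -/
theorem nonempty_cornerPart_head [IsSimpleModule he.Corner W] :
    Nonempty (W ≃ₗ[he.Corner] cornerPart he (head A (inducedModule he W))) := by
  let q := (Module.jacobson A (inducedModule he W)).mkQ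
  let f : W →ₗ[he.Corner] cornerPart he (head A (inducedModule he W)) :=
    { toFun := fun w => ⟨q (indTmul he (leftIdealGen e) w), by
        rw [mem_cornerPart, ← map_smul, idem_smul_gen]⟩
      map_add' := fun v w => Subtype.ext <| by
        change q _ = q _ + q _
        rw [indTmul_add, map_add]
      map_smul' := fun b w => Subtype.ext <| by
        change q _ = b.1 • q _
        rw [← corner_smul_gen, map_smul] }
  refine ⟨LinearEquiv.ofBijective f ⟨?_, ?_⟩⟩
  · rw [← LinearMap.ker_eq_bot, LinearMap.ker_eq_bot']
    intro w hw
    have h1 : q (indTmul he (leftIdealGen e) w) = 0 := congrArg Subtype.val hw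
    rw [Submodule.mkQ_apply, Submodule.Quotient.mk_eq_zero, jacobson_inducedModule he] at h1
    -- Membership in `indRad` is tested with multiplier `1`, where the retraction returns `w`
    -- itself.
    have h2 := h1 1
    rwa [one_smul, retract_gen] at h2
  · rintro ⟨y, hy⟩
    obtain ⟨m, rfl⟩ := Submodule.mkQ_surjective _ y
    -- The class of `m` is fixed by `e`, so it is also the class of `e m = e ⊗ retract m`.
    refine ⟨retract he m, Subtype.ext ?_⟩
    change q _ = q m
    rw [← idem_smul_eq, map_smul]
    exact hy

/-- A simple module `S` with `e S ≅ W` is isomorphic to `Hd(A e ⊗ W)`. -/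
theorem nonempty_head_equiv [IsSimpleModule he.Corner W] [IsSimpleModule A N]
    (f : W ≃ₗ[he.Corner] cornerPart he N) :
    Nonempty (head A (inducedModule he W) ≃ₗ[A] N) := by
  let g : inducedModule he W →ₗ[A] N := inducedLift he f.toLinearMap
  have := IsSimpleModule.nontrivial he.Corner W
  obtain ⟨w, hw⟩ := exists_ne (0 : W)
  -- The map `g` sends `e ⊗ w` to `e f(w) = f(w)`, which is nonzero.
  have hg : g ≠ 0 := by
    intro h
    have h1 : g (indTmul he (leftIdealGen e) w) = 0 := by rw [h]; rfl
    have h2 : e • (f w).1 = 0 := h1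
    rw [(mem_cornerPart he).mp (f w).2] at h2
    exact hw (f.map_eq_zero_iff.mp (Subtype.ext h2))
  have hs : Function.Surjective g := (LinearMap.surjective_or_eq_zero g).resolve_right hg
  -- The quotient by the kernel is the simple module `N`, so the kernel is the unique maximal
  -- submodule, that is, the radical.
  have hk : IsCoatom (LinearMap.ker g) := by
    rw [← isSimpleModule_iff_isCoatom]
    exact IsSimpleModule.congr (g.quotKerEquivOfSurjective hs)
  have hj : Module.jacobson A (inducedModule he W) = LinearMap.ker g :=
    (jacobson_inducedModule he).trans (eq_indRad_of_isCoatom he hk).symm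
  exact ⟨(Submodule.quotEquivOfEq _ _ hj).trans (g.quotKerEquivOfSurjective hs)⟩

end Induced

/-! ### Inflation along a surjective ring homomorphism. -/

section RestrictScalars

/-- A `B`-module annihilated by the kernel of a surjective ring homomorphism `f : B → B'` is
inflated from a `B'`-module. -/
theorem exists_restrictScalars_equiv {B : Type u} {B' : Type w} [Ring B] [Ring B'] (f : B →+* B')
    (hf : Function.Surjective f) (W : Type v) [AddCommGroup W] [Module B W]
    (hW : ∀ b, f b = 0 → ∀ w : W, b • w = 0) :
    ∃ T : ModuleCat.{v} B', Nonempty (W ≃ₗ[B] (ModuleCat.restrictScalars f).obj T) := by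
  have h : ∀ b c, f b = f c → ∀ w : W, b • w = c • w := fun b c hbc w => by
    rw [← sub_eq_zero, ← sub_smul]
    exact hW _ (by rw [map_sub, hbc, sub_self]) w
  -- A set-theoretic section suffices: it respects sums, products and the unit up to the kernel of
  -- `f`, which acts as zero.
  let σ := Function.surjInv hf
  have hσ : ∀ x, f (σ x) = x := Function.surjInv_eq hf
  let _ : Module B' W :=
    { smul := fun x w => σ x • w
      one_smul := fun w => (h _ 1 (by rw [hσ, map_one]) w).trans (one_smul B w)
      mul_smul := fun x y w =>
        (h _ (σ x * σ y) (by rw [map_mul, hσ, hσ, hσ]) w).trans (mul_smul _ _ w)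
      smul_zero := fun x => smul_zero (σ x)
      smul_add := fun x v w => smul_add (σ x) v w
      add_smul := fun x y w =>
        (h _ (σ x + σ y) (by rw [map_add, hσ, hσ, hσ]) w).trans (add_smul _ _ w)
      zero_smul := fun w => (h _ 0 (by rw [hσ, map_zero]) w).trans (zero_smul B w) }
  exact ⟨ModuleCat.of B' W, ⟨{ AddEquiv.refl W with
    map_smul' := fun b w => h b (σ (f b)) (hσ _).symm w }⟩⟩

variable {B : Type u} {B' : Type w} [Ring B] [Ring B'] (f : B →+* B')

/-- Simplicity says that each nonzero element generates, and by surjectivity of `f` an element has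
the same multiples over both rings. -/
theorem isSimpleModule_restrictScalars_iff (hf : Function.Surjective f) (T : ModuleCat.{v} B') :
    IsSimpleModule B ((ModuleCat.restrictScalars f).obj T) ↔ IsSimpleModule B' T := by
  rw [isSimpleModule_iff_toSpanSingleton_surjective,
    isSimpleModule_iff_toSpanSingleton_surjective]
  refine and_congr Iff.rfl
    (forall_congr' fun x => forall_congr' fun hx => forall_congr' fun y => ?_)
  constructor
  · rintro ⟨b, hb⟩
    exact ⟨f b, hb⟩
  · rintro ⟨b', hb⟩
    obtain ⟨b, rfl⟩ := hf b'
    exact ⟨b, hb⟩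

/-- Restriction of scalars along a surjective ring homomorphism reflects isomorphisms. -/
theorem nonempty_equiv_of_restrictScalars (hf : Function.Surjective f) {T T' : ModuleCat.{v} B'}
    (g : (ModuleCat.restrictScalars f).obj T ≃ₗ[B] (ModuleCat.restrictScalars f).obj T') :
    Nonempty (T ≃ₗ[B'] T') :=
  ⟨{ g.toAddEquiv with
    map_smul' := fun b' x => by
      obtain ⟨b, rfl⟩ := hf b'
      exact g.map_smul b x }⟩

end RestrictScalars

/-! ### Orders of subquotients under composition of subgroups. -/

section SectionOrder

variable {G H K : Type u} [Group G] [Group H] [Group K]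

theorem card_quot_mul_card_bot (s : GroupSection G) :
    Nat.card s.top = Nat.card s.quot * Nat.card s.bot := by
  have h := Subgroup.card_eq_card_quotient_mul_card_subgroup (s.bot.subgroupOf s.top)
  rwa [Nat.card_congr (Subgroup.subgroupOfEquivOfLe s.le).toEquiv] at h

/-- Passing from `s` to `t` shrinks the numerator and enlarges the denominator of the subquotient.
-/
theorem card_quot_le [Finite G] {s t : GroupSection G} (h1 : t.top ≤ s.top)
    (h2 : s.bot ≤ t.bot) : Nat.card t.quot ≤ Nat.card s.quot := by
  refine Nat.le_of_mul_le_mul_right (c := Nat.card t.bot) ?_ Nat.card_pos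
  rw [← card_quot_mul_card_bot]
  refine (Subgroup.card_le_of_le h1).trans ?_
  rw [card_quot_mul_card_bot]
  exact Nat.mul_le_mul_left _ (Subgroup.card_le_of_le h2)

theorem card_leftSection_star_le [Finite G] (L : Subgroup (G × H)) (M : Subgroup (H × K)) :
    Nat.card (leftSection (star L M)).quot ≤ Nat.card (leftSection L).quot :=
  card_quot_le (p₁_star_le L M) (k₁_le_star L M)

theorem card_rightSection_star_le [Finite K] (L : Subgroup (G × H)) (M : Subgroup (H × K)) :
    Nat.card (rightSection (star L M)).quot ≤ Nat.card (rightSection M).quot :=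
  card_quot_le (p₂_star_le L M) (k₂_le_star L M)

theorem leftSection_star_eq [Finite G] (L : Subgroup (G × H)) (M : Subgroup (H × K))
    (h : Nat.card (leftSection (star L M)).quot = Nat.card (leftSection L).quot) :
    leftSection (star L M) = leftSection L :=
  section_eq_of_le (p₁_star_le L M) (k₁_le_star L M) h.symm

theorem rightSection_star_eq [Finite K] (L : Subgroup (G × H)) (M : Subgroup (H × K))
    (h : Nat.card (rightSection (star L M)).quot = Nat.card (rightSection M).quot) :
    rightSection (star L M) = rightSection M :=
  section_eq_of_le (p₂_star_le L M) (k₂_le_star L M) h.symm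

theorem card_leftSection_eq_card_rightSection (L : Subgroup (G × H)) :
    Nat.card (leftSection L).quot = Nat.card (rightSection L).quot := by
  obtain ⟨φ, -⟩ := exists_eq_quintuple L
  exact (Nat.card_congr φ.toEquiv).symm

theorem exists_eq_quintuple_of_eq {L : Subgroup (G × H)} {s : GroupSection G}
    {t : GroupSection H} (hs : leftSection L = s) (ht : rightSection L = t) :
    ∃ φ : t.quot ≃* s.quot, L = quintuple s t φ := by
  subst hs ht
  exact exists_eq_quintuple L

theorem nonempty_quot_equiv_of_eq {s t : GroupSection G} (h : s = t) :
    Nonempty (s.quot ≃* t.quot) := by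
  subst h
  exact ⟨MulEquiv.refl _⟩

theorem leftSection_idem (s : GroupSection G) : leftSection s.idem = s :=
  leftSection_quintuple s s _

theorem rightSection_idem (s : GroupSection G) : rightSection s.idem = s :=
  rightSection_quintuple s s _

theorem idem_star_quintuple (s : GroupSection G) (t : GroupSection H) (φ : t.quot ≃* s.quot) :
    star s.idem (quintuple s t φ) = quintuple s t φ :=
  quintuple_star_quintuple _ _ _ _ _

/-- By Goursat's description, `L` is a quintuple whose first section is `leftSection L`. This makes
each morphism factor through the idempotent of its own left section. -/
theorem leftSection_idem_star (L : Subgroup (G × H)) : star (leftSection L).idem L = L := by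
  obtain ⟨φ, hφ⟩ := exists_eq_quintuple L
  exact (congrArg (star _) hφ).trans ((idem_star_quintuple _ _ φ).trans hφ.symm)

/-- If `L` lies in `e * Sub(G × G) * e` with `e = e_{(P, K)}` then either `|p₁(L) / k₁(L)|` is
smaller than `|P / K|` or `L = (P, K, α, P, K)`. -/
theorem card_lt_or_eq_quintuple [Finite G] (s : GroupSection G) (L : Subgroup (G × G))
    (hL : star (star s.idem L) s.idem = L) :
    Nat.card (leftSection L).quot < Nat.card s.quot ∨ ∃ α, L = quintuple s s α := by
  -- Both bracketings serve: with `e` as left factor the left sections are compared, with `e` as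
  -- right factor the right ones.
  have hl : star s.idem (star L s.idem) = L := by rwa [← star_assoc]
  have hle := card_leftSection_star_le s.idem (star L s.idem)
  rw [hl, leftSection_idem] at hle
  refine hle.lt_or_eq.imp_right fun heq => exists_eq_quintuple_of_eq ?_ ?_
  · have := leftSection_star_eq s.idem (star L s.idem) (by rw [hl, leftSection_idem, heq])
    rwa [hl, leftSection_idem] at this
  · have := rightSection_star_eq (star s.idem L) s.idem (by
      rw [hL, rightSection_idem, ← card_leftSection_eq_card_rightSection, heq])
    rwa [hL, rightSection_idem] at this

/-- If some `(P, K, α, P, K)` factors through `e_{(P', K')}` then `|P / K| ≤ |P' / K'|`, with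
equality only if `P / K ≅ P' / K'`. -/
theorem card_lt_or_nonempty_equiv [Finite G] [Finite H] (s : GroupSection G)
    (t : GroupSection H) (X : Subgroup (G × H)) (Y : Subgroup (H × G)) (α : s.quot ≃* s.quot)
    (h : star (star X t.idem) Y = quintuple s s α) :
    Nat.card s.quot < Nat.card t.quot ∨ Nonempty (s.quot ≃* t.quot) := by
  -- These bounds chain as `|P / K| ≤ |p₁(N) / k₁(N)| = |p₂(N) / k₂(N)| ≤ |P' / K'|` with `N = X *
  -- e_{(P', K')}`. If the ends agree, `N` has left section `s` and right section `t`, and its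
  -- quintuple supplies the isomorphism.
  have h1 := card_leftSection_star_le (star X t.idem) Y
  have h2 := card_rightSection_star_le X t.idem
  rw [h, leftSection_quintuple, card_leftSection_eq_card_rightSection] at h1
  rw [rightSection_idem] at h2
  refine (h1.trans h2).lt_or_eq.imp_right fun heq => ?_
  have h3 : rightSection (star X t.idem) = t := by
    have := rightSection_star_eq X t.idem
      (by rw [rightSection_idem]; exact h2.antisymm (heq ▸ h1))
    rwa [rightSection_idem] at this
  have h4 : leftSection (star X t.idem) = s := by
    have := leftSection_star_eq (star X t.idem) Y (by
      rw [h, leftSection_quintuple, card_leftSection_eq_card_rightSection (star X t.idem), h3,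
        heq])
    rw [h, leftSection_quintuple] at this
    exact this.symm
  obtain ⟨φ, -⟩ := exists_eq_quintuple_of_eq h4 h3
  exact ⟨φ.symm⟩

end SectionOrder

/-! ### Idempotents and factorizations in a closed subcategory. -/

namespace BisetSubcategory

variable {ι : Type u} {𝒢 : ι → Type u} [∀ i, Group (𝒢 i)] [∀ i, Finite (𝒢 i)]
variable {C : BisetSubcategory 𝒢}

/-- The closure condition only yields some automorphism `φ` of `P / K`. It has finite order, so a
power of its morphism is the idempotent. -/
theorem IsClosed.idem_mem (hC : C.IsClosed) {i : ι} (hi : i ∈ C.obj) (s : GroupSection (𝒢 i))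
    (hs : C.Realizes s.quot) : s.idem ∈ C.hom i i := by
  obtain ⟨φ, hφ⟩ := hC s.quot hs i hi i hi s s ⟨MulEquiv.refl _⟩ ⟨MulEquiv.refl _⟩
  let φ' : MulAut s.quot := φ
  -- Exponents start at `1`, since exponent `0` would be the claim itself.
  have hpow : ∀ n : ℕ, quintuple s s (φ' ^ (n + 1)) ∈ C.hom i i := by
    intro n
    induction n with
    | zero => rw [zero_add, pow_one]; exact hφ
    | succ n ih =>
      have := C.comp_mem ih hφ
      rw [quintuple_star_quintuple] at this
      rw [pow_succ]
      exact this
  have := hpow (orderOf φ' - 1)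
  rw [Nat.sub_add_cancel (orderOf_pos φ'), pow_orderOf_eq_one] at this
  exact this

/-- The section `(p₁(L), k₁(L))` for a morphism `L` of a closed subcategory. -/
def IsClosed.leftIdemSection (hC : C.IsClosed) {X Y : C.Obj} (L : X ⟶ Y) : C.IdemSection where
  obj := Y
  sec := leftSection L.1
  idem_mem := hC.idem_mem Y.2 _ ⟨Y.1, X.1, L.1, L.2, ⟨MulEquiv.refl _⟩⟩

theorem IsClosed.comp_leftIdemSection (hC : C.IsClosed) {X Y : C.Obj} (L : X ⟶ Y) :
    L ≫ (hC.leftIdemSection L).idemMor = L :=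
  Subtype.ext (leftSection_idem_star L.1)

namespace IdemSection

variable (s t : C.IdemSection)

theorem realizes : C.Realizes s.sec.quot :=
  ⟨s.obj.1, s.obj.1, s.sec.idem, s.idem_mem,
    nonempty_quot_equiv_of_eq (leftSection_idem s.sec)⟩

variable {s t} in
/-- An automorphism in `C` of a section factors through any isomorphic section. -/
theorem Iso.exists_factor (hC : C.IsClosed) (h : s.Iso t) :
    ∃ (M : s.obj ⟶ t.obj) (L : t.obj ⟶ s.obj) (α : s.autGroup),
      (M ≫ t.idemMor) ≫ L = s.autMor α := by
  obtain ⟨φ⟩ := h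
  obtain ⟨α, hα⟩ := hC s.sec.quot s.realizes s.obj.1 s.obj.2 t.obj.1 t.obj.2 s.sec t.sec
    ⟨MulEquiv.refl _⟩ ⟨φ⟩
  obtain ⟨β, hβ⟩ := hC s.sec.quot s.realizes t.obj.1 t.obj.2 s.obj.1 s.obj.2 t.sec s.sec
    ⟨φ.symm⟩ ⟨MulEquiv.refl _⟩
  let M : s.obj ⟶ t.obj := ⟨_, hβ⟩
  let L : t.obj ⟶ s.obj := ⟨_, hα⟩
  have h1 : M ≫ t.idemMor = M := Subtype.ext (idem_star_quintuple _ _ _)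
  -- The isomorphisms `α` and `β` come from separate uses of the closure condition and need not be
  -- inverse, so the composite is some automorphism rather than the identity.
  obtain ⟨γ, hγ⟩ := s.exists_autMor (L := M ≫ L) (quintuple_star_quintuple _ _ _ α β)
  exact ⟨M, L, γ, by rw [h1, hγ]⟩

theorem card_lt_or_exists_autMor {L : s.obj ⟶ s.obj} (hL : s.idemMor ≫ L ≫ s.idemMor = L) :
    Nat.card (leftSection L.1).quot < Nat.card s.sec.quot ∨ ∃ α, L = s.autMor α :=
  (card_lt_or_eq_quintuple s.sec L.1 (congrArg Subtype.val hL)).imp_right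
    fun ⟨_, hα⟩ => s.exists_autMor hα

theorem ne_autMor_of_factor (hst : ¬ s.Iso t) (hle : Nat.card t.sec.quot ≤ Nat.card s.sec.quot)
    (Y : s.obj ⟶ t.obj) (X : t.obj ⟶ s.obj) (α : s.autGroup) :
    Y ≫ t.idemMor ≫ X ≠ s.autMor α := fun h =>
  (card_lt_or_nonempty_equiv s.sec t.sec X.1 Y.1 α.1 (congrArg Subtype.val h)).elim
    (fun h => h.not_ge hle) hst

end IdemSection

end BisetSubcategory

/-! ### Scalars acting through an algebra. -/

section AlgebraAction

variable {R A M : Type*} [CommRing R] [Ring A] [Algebra R A] [AddCommGroup M] [Module A M]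

/-- `M` is given no `R`-module structure, so the scalar is absorbed into `A` as `r • 1`. -/
theorem smul_smul_eq_zero {a : A} {x : M} (h : a • x = 0) (r : R) : (r • a) • x = 0 := by
  rw [← one_mul a, ← smul_mul_assoc, mul_smul, h, smul_zero]

/-- Values of `κ` and indices are units of `R`; this allows them to be dropped when deciding whether
a morphism annihilates an element. -/
theorem smul_eq_zero_of_unit_smul {a : A} {x : M} (u : Rˣ) (h : ((u : R) • a) • x = 0) :
    a • x = 0 := by
  have := smul_smul_eq_zero h (u⁻¹ : Rˣ).val
  rwa [smul_smul, Units.inv_mul, one_smul] at this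

end AlgebraAction

/-! ### The corner ring `e' A e'` and the ideal `R J_e`. -/

namespace BisetSubcategory

open TwistedCategoryAlgebra

variable {ι : Type u} {𝒢 : ι → Type u} [∀ i, Group (𝒢 i)] [∀ i, Finite (𝒢 i)]
variable {C : BisetSubcategory 𝒢} {R : Type u} [CommRing R] (hR : C.OrdersInvertible R)
variable [Finite (Mor C.Obj)]

namespace IdemSection

variable (s t : C.IdemSection)

/-- The factor `[G : K]` in `e'` cancels the constant value `[G : K]⁻¹` of `κ` on `Γ_e`. -/
theorem idemElt_mul_autMor (α : s.autGroup) :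
    s.idemElt hR * of (kappa hR) ⟨s.obj, s.obj, s.autMor α⟩ =
      of (kappa hR) ⟨s.obj, s.obj, s.autMor α⟩ := by
  rw [idemElt, TwistedCategoryAlgebra.smul_mul, ← autMor_one, of_mul_of_comp, autMor_comp,
    kappa_autMor, smul_smul, one_mul]
  exact (congrArg (· • _) (s.indexUnit hR).mul_inv).trans (one_smul R _)

theorem autMor_mul_idemElt (α : s.autGroup) :
    of (kappa hR) ⟨s.obj, s.obj, s.autMor α⟩ * s.idemElt hR =
      of (kappa hR) ⟨s.obj, s.obj, s.autMor α⟩ := by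
  rw [idemElt, mul_smul', ← autMor_one, of_mul_of_comp, autMor_comp,
    kappa_autMor, smul_smul, mul_one]
  exact (congrArg (· • _) (s.indexUnit hR).mul_inv).trans (one_smul R _)

theorem proj_surjective : Function.Surjective (s.proj hR) := by
  intro x
  induction x using MonoidAlgebra.induction_on with
  | of α =>
    refine ⟨toCorner _ ((s.sec.bot.index : R) •
      of (kappa hR) ⟨s.obj, s.obj, s.autMor α⟩), s.proj_autMor hR α _ ?_⟩
    rw [toCorner_val, mul_smul', TwistedCategoryAlgebra.smul_mul, idemElt_mul_autMor,
      autMor_mul_idemElt]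
  | add x y hx hy =>
    obtain ⟨a, rfl⟩ := hx
    obtain ⟨b, rfl⟩ := hy
    exact ⟨a + b, map_add _ _ _⟩
  | smul r x hx =>
    obtain ⟨a, rfl⟩ := hx
    refine ⟨toCorner _ (r • a.1), ?_⟩
    change s.projLin hR (s.idemElt hR * (r • a.1) * s.idemElt hR) = r • s.projLin hR a.1
    rw [mul_smul', TwistedCategoryAlgebra.smul_mul, map_smul,
      corner_mul_left (s.isIdempotentElem hR), corner_mul_right (s.isIdempotentElem hR)]

/-- If the morphisms in `J_e` annihilate `M` then so does the kernel of `proj`. -/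
theorem smul_eq_zero_of_proj_eq_zero {M : Type v} [AddCommGroup M] [Module (TwistedAlgebra hR) M]
    (hM : ∀ L : s.obj ⟶ s.obj, s.idemMor ≫ L ≫ s.idemMor = L → (∀ α, L ≠ s.autMor α) →
      ∀ x : M, of (kappa hR) ⟨s.obj, s.obj, L⟩ • x = 0)
    (b : s.cornerRing hR) (hb : s.proj hR b = 0) (x : M) : b.1 • x = 0 := by
  -- `σ` is the linear splitting `α ↦ [G : K] (P, K, α, P, K)` of the projection. Subtracting it
  -- removes the `Γ_e`-component of `e' a e'` and leaves a combination of morphisms that annihilate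
  -- `M`.
  let σ : (s.autGroup →₀ R) →ₗ[R] TwistedAlgebra hR := Finsupp.linearCombination R fun α =>
    (s.sec.bot.index : R) • of (kappa hR) ⟨s.obj, s.obj, s.autMor α⟩
  have key : ∀ a : TwistedAlgebra hR, (s.idemElt hR * a * s.idemElt hR -
      σ (s.projLin hR (s.idemElt hR * a * s.idemElt hR)).coeff) • x = 0 := by
    intro a
    induction a using induction_of with
    | h0 => simp
    | hadd a b ha hb =>
      rw [mul_add, add_mul, map_add, MonoidAlgebra.coeff_add, map_add, add_sub_add_comm,
        add_smul, ha, hb, add_zero]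
    | hsmul r a ha =>
      rw [mul_smul', TwistedCategoryAlgebra.smul_mul, map_smul, MonoidAlgebra.coeff_smul,
        map_smul, ← smul_sub]
      exact smul_smul_eq_zero ha r
    | hof m =>
      obtain ⟨r, L, hL, h⟩ := s.corner_of hR m
      rw [h, map_smul, MonoidAlgebra.coeff_smul, map_smul, ← smul_sub]
      refine smul_smul_eq_zero ?_ r
      by_cases hα : ∃ α, L = s.autMor α
      · obtain ⟨α, rfl⟩ := hα
        rw [projLin_autMor, MonoidAlgebra.coeff_single, Finsupp.linearCombination_single,
          smul_smul]
        have : ((s.indexUnit hR)⁻¹ : Rˣ).val * (s.sec.bot.index : R) = 1 :=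
          (s.indexUnit hR).inv_mul
        rw [this, one_smul, sub_self, zero_smul]
      · have hα' : ∀ α, L ≠ s.autMor α := fun α h => hα ⟨α, h⟩
        rw [s.projLin_of_ne hR hα', MonoidAlgebra.coeff_zero, map_zero, sub_zero]
        exact hM L hL hα' x
  have h := key b.1
  rw [corner_mul_left (s.isIdempotentElem hR), corner_mul_right (s.isIdempotentElem hR)] at h
  have hb' : s.projLin hR b.1 = 0 := hb
  rwa [hb', MonoidAlgebra.coeff_zero, map_zero, sub_zero] at h

/-- `e' A f' A e' ⊆ R J_e` unless `|P / K|` is smaller than the order of the quotient for `f`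
or the two sections are isomorphic. -/
theorem projLin_eq_zero_of_factor (hst : ¬ s.Iso t)
    (hle : Nat.card t.sec.quot ≤ Nat.card s.sec.quot) (a b : TwistedAlgebra hR) :
    s.projLin hR (s.idemElt hR * (a * t.idemElt hR * b) * s.idemElt hR) = 0 := by
  induction a using induction_of with
  | h0 => simp
  | hadd x y hx hy => simp only [add_mul, mul_add, map_add, hx, hy, add_zero]
  | hsmul r x hx =>
    simp only [TwistedCategoryAlgebra.smul_mul, mul_smul', map_smul, hx, smul_zero]
  | hof m =>
    induction b using induction_of with
    | h0 => simp
    | hadd x y hx hy => simp only [add_mul, mul_add, map_add, hx, hy, add_zero]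
    | hsmul r x hx =>
      simp only [TwistedCategoryAlgebra.smul_mul, mul_smul', map_smul, hx, smul_zero]
    | hof n =>
      obtain ⟨X, Y, f⟩ := m
      obtain ⟨Z, W, g⟩ := n
      simp only [idemElt, TwistedCategoryAlgebra.smul_mul, mul_smul', map_smul]
      -- The product of basis elements vanishes unless all four endpoints match, and then it is a
      -- multiple of a single composite through `e_t`.
      by_cases hX : t.obj = X
      · by_cases hW : W = t.obj
        · by_cases hY : Y = s.obj
          · by_cases hZ : s.obj = Z
            · subst hX hY hZ hW
              simp only [of_mul_of_comp, TwistedCategoryAlgebra.smul_mul, mul_smul', map_smul]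
              rw [s.projLin_of_ne hR]
              · simp only [smul_zero]
              · intro α
                have := s.ne_autMor_of_factor t hst hle (s.idemMor ≫ g) (f ≫ s.idemMor) α
                simpa only [Category.assoc] using this
            · rw [mul_assoc, mul_assoc, mul_assoc, of_mul_of_ne _ hZ]
              simp
          · rw [← mul_assoc, ← mul_assoc, of_mul_of_ne _ hY]
            simp
        · rw [mul_assoc (of _ _) (of _ _) (of _ _), of_mul_of_ne _ hW]
          simp
      · rw [of_mul_of_ne (kappa hR) (t := ⟨X, Y, f⟩) hX]
        simp

/-! ### Which section idempotents act nontrivially on a module. -/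

variable (M : Type v) [AddCommGroup M] [Module (TwistedAlgebra hR) M]

theorem idemElt_smul_eq_zero_iff (x : M) : s.idemElt hR • x = 0 ↔
    of (kappa hR) ⟨s.obj, s.obj, s.idemMor⟩ • x = 0 :=
  ⟨smul_eq_zero_of_unit_smul (s.indexUnit hR), fun h => smul_smul_eq_zero h _⟩

variable {s t M} in
/-- Idempotents of isomorphic sections annihilate the same modules. -/
theorem Iso.exists_smul_ne_zero (hC : C.IsClosed) (h : s.Iso t)
    (hs : ∃ x : M, s.idemElt hR • x ≠ 0) : ∃ x : M, t.idemElt hR • x ≠ 0 := by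
  by_contra! ht
  obtain ⟨x, hx⟩ := hs
  refine hx ((s.idemElt_smul_eq_zero_iff hR M x).mpr ?_)
  obtain ⟨N, L, α, h⟩ := h.exists_factor hC
  -- This automorphism morphism factors through `e_t`, which annihilates `M`.
  have h1 : ∀ y : M, of (kappa hR) ⟨s.obj, s.obj, s.autMor α⟩ • y = 0 := by
    intro y
    rw [← h]
    refine smul_eq_zero_of_unit_smul ((kappa hR).val L (N ≫ t.idemMor)) ?_
    rw [← of_mul_of_comp, mul_smul]
    refine (congrArg (_ • ·) (smul_eq_zero_of_unit_smul ((kappa hR).val t.idemMor N) ?_)).trans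
      (smul_zero _)
    rw [← of_mul_of_comp, mul_smul]
    exact (t.idemElt_smul_eq_zero_iff hR M _).mp (ht _)
  -- As `α` is invertible, `e_s` is the composite of the morphisms of `α` and `α⁻¹`, so it
  -- annihilates `M` as well.
  refine smul_eq_zero_of_unit_smul ((kappa hR).val (s.autMor α) (s.autMor α⁻¹)) ?_
  rw [← autMor_one, ← mul_inv_cancel α, ← autMor_comp, ← of_mul_of_comp, mul_smul]
  exact h1 _

/-- The idempotent of the left section fixes `L` under composition, hence fixes `L x` up to a unit;
so `L x` is itself the witness. -/
theorem _root_.BisetAlg.BisetSubcategory.IsClosed.leftIdemSection_smul_ne_zero (hC : C.IsClosed)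
    {X Y : C.Obj} (L : X ⟶ Y) {x : M} (hx : of (kappa hR) ⟨X, Y, L⟩ • x ≠ 0) :
    ∃ y : M, (hC.leftIdemSection L).idemElt hR • y ≠ 0 := by
  refine ⟨of (kappa hR) ⟨X, Y, L⟩ • x, fun h => hx ?_⟩
  rw [idemElt_smul_eq_zero_iff, ← mul_smul] at h
  have h2 := of_mul_of_comp (kappa hR) (hC.leftIdemSection L).idemMor L
  have h3 : of (kappa hR) ⟨X, Y, L ≫ (hC.leftIdemSection L).idemMor⟩ =
      of (kappa hR) ⟨X, Y, L⟩ :=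
    congrArg (fun N : X ⟶ Y => of (kappa hR) ⟨X, Y, N⟩) (hC.comp_leftIdemSection L)
  exact smul_eq_zero_of_unit_smul _
    ((congrArg (· • x) (h2.trans (congrArg (_ • ·) h3))).symm.trans h)

/-- Were all section idempotents to annihilate `M`, every morphism would, through its left section,
and so would `1`. -/
theorem _root_.BisetAlg.BisetSubcategory.IsClosed.exists_idemElt_smul_ne_zero (hC : C.IsClosed)
    [Nontrivial M] : ∃ (s : C.IdemSection) (x : M), s.idemElt hR • x ≠ 0 := by
  by_contra! h
  obtain ⟨x, hx⟩ := exists_ne (0 : M)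
  have h1 : ∀ a : TwistedAlgebra hR, a • x = 0 := by
    intro a
    induction a using induction_of with
    | h0 => rw [zero_smul]
    | hadd a b ha hb => rw [add_smul, ha, hb, add_zero]
    | hsmul r a ha => exact smul_smul_eq_zero ha r
    | hof m =>
      by_contra hm
      obtain ⟨y, hy⟩ := hC.leftIdemSection_smul_ne_zero hR M m.hom hm
      exact hy (h _ y)
  exact hx ((one_smul _ x).symm.trans (h1 1))

/-! ### The simple modules `Hd(A e' ⊗ Inf(T))` and their isomorphisms. -/

variable (T : ModuleCat.{u} (MonoidAlgebra R s.autGroup))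

theorem isSimpleModule_inflation [IsSimpleModule (MonoidAlgebra R s.autGroup) T] :
    IsSimpleModule (s.cornerRing hR) (s.inflation hR T) :=
  (isSimpleModule_restrictScalars_iff _ (s.proj_surjective hR) T).mpr inferInstance

theorem isSimpleModule_headModule [IsSimpleModule (MonoidAlgebra R s.autGroup) T] :
    IsSimpleModule (TwistedAlgebra hR) (s.headModule hR T) :=
  have := s.isSimpleModule_inflation hR T
  isSimpleModule_head (s.isIdempotentElem hR) (W := s.inflation hR T)

theorem nonempty_inflation_equiv [IsSimpleModule (MonoidAlgebra R s.autGroup) T] :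
    Nonempty (s.inflation hR T ≃ₗ[s.cornerRing hR]
      cornerPart (s.isIdempotentElem hR) (s.headModule hR T)) :=
  have := s.isSimpleModule_inflation hR T
  nonempty_cornerPart_head (s.isIdempotentElem hR) (W := s.inflation hR T)

theorem exists_smul_headModule_ne_zero [IsSimpleModule (MonoidAlgebra R s.autGroup) T] :
    ∃ x : s.headModule hR T, s.idemElt hR • x ≠ 0 := by
  have := s.isSimpleModule_inflation hR T
  have := IsSimpleModule.nontrivial (s.cornerRing hR) (s.inflation hR T)
  obtain ⟨f⟩ := s.nonempty_inflation_equiv hR T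
  obtain ⟨w, hw⟩ := exists_ne (0 : s.inflation hR T)
  refine ⟨(f w).1, fun h => hw (f.map_eq_zero_iff.mp (Subtype.ext ?_))⟩
  rwa [(mem_cornerPart _).mp (f w).2] at h

/-- `Hd(A e' ⊗ Inf(T))` is annihilated by the idempotents of non-isomorphic sections with
quotient of order at most `|P / K|`. -/
theorem iso_of_smul_headModule_ne_zero [IsSimpleModule (MonoidAlgebra R s.autGroup) T]
    (hle : Nat.card t.sec.quot ≤ Nat.card s.sec.quot)
    (ht : ∃ x : s.headModule hR T, t.idemElt hR • x ≠ 0) : s.Iso t := by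
  by_contra hst
  have := s.isSimpleModule_headModule hR T
  obtain ⟨f⟩ := s.nonempty_inflation_equiv hR T
  obtain ⟨x, hx⟩ := s.exists_smul_headModule_ne_zero hR T
  obtain ⟨y, hy⟩ := ht
  -- Simplicity gives `b` taking `e'_s x` to `y` and `a` taking `e'_t y` back to `x`. Hence `c =
  -- e'_s a e'_t b e'_s` fixes `z = e'_s x ≠ 0`, although `c` projects to zero and so annihilates
  -- `Inf(T)`.
  obtain ⟨b, rfl⟩ := exists_smul_eq (A := TwistedAlgebra hR) hx y
  obtain ⟨a, ha⟩ := exists_smul_eq (A := TwistedAlgebra hR) hy x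
  let z : cornerPart (s.isIdempotentElem hR) (s.headModule hR T) :=
    ⟨s.idemElt hR • x, idem_smul_mem (s.isIdempotentElem hR) x⟩
  let c := toCorner (s.isIdempotentElem hR) (a * t.idemElt hR * b)
  have h1 : c • z = z := Subtype.ext <| by
    change (s.idemElt hR * (a * t.idemElt hR * b) * s.idemElt hR) • s.idemElt hR • x =
      s.idemElt hR • x
    rw [smul_smul, mul_assoc, (s.isIdempotentElem hR).eq]
    simp only [mul_smul]
    rw [ha]
  have h2 : c • z = 0 := by
    obtain ⟨w, hw⟩ := f.surjective z
    rw [← hw, ← map_smul]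
    have h3 : s.proj hR c = 0 := s.projLin_eq_zero_of_factor hR t hst hle a b
    have h4 : c • w = s.proj hR c • (show T from w) := rfl
    rw [h4, h3, zero_smul]
    exact map_zero f
  exact hx (congrArg Subtype.val (h1.symm.trans h2))

/-- The preceding criterion needs the other quotient to be no larger; the two modules being
isomorphic, it can be applied from whichever side has the larger quotient. -/
theorem iso_of_headModule_equiv [IsSimpleModule (MonoidAlgebra R s.autGroup) T]
    (T' : ModuleCat.{u} (MonoidAlgebra R t.autGroup))
    [IsSimpleModule (MonoidAlgebra R t.autGroup) T']
    (g : s.headModule hR T ≃ₗ[TwistedAlgebra hR] t.headModule hR T') : s.Iso t := by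
  rcases le_total (Nat.card t.sec.quot) (Nat.card s.sec.quot) with hle | hle
  · refine s.iso_of_smul_headModule_ne_zero hR t T hle ?_
    obtain ⟨x, hx⟩ := t.exists_smul_headModule_ne_zero hR T'
    refine ⟨g.symm x, fun h => hx ?_⟩
    rwa [← map_smul, g.symm.map_eq_zero_iff] at h
  · have : t.Iso s := by
      refine t.iso_of_smul_headModule_ne_zero hR s T' hle ?_
      obtain ⟨x, hx⟩ := s.exists_smul_headModule_ne_zero hR T
      refine ⟨g x, fun h => hx ?_⟩
      rwa [← map_smul, g.map_eq_zero_iff] at h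
    exact this.map MulEquiv.symm

/-- Multiplying by `e'` recovers `Inf(T)` from the head, and inflation along the surjection `proj`
reflects isomorphisms. -/
theorem nonempty_equiv_of_headModule_equiv [IsSimpleModule (MonoidAlgebra R s.autGroup) T]
    (T' : ModuleCat.{u} (MonoidAlgebra R s.autGroup))
    [IsSimpleModule (MonoidAlgebra R s.autGroup) T']
    (g : s.headModule hR T ≃ₗ[TwistedAlgebra hR] s.headModule hR T') :
    Nonempty (T ≃ₗ[MonoidAlgebra R s.autGroup] T') := by
  obtain ⟨f⟩ := s.nonempty_inflation_equiv hR T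
  obtain ⟨f'⟩ := s.nonempty_inflation_equiv hR T'
  exact nonempty_equiv_of_restrictScalars _ (s.proj_surjective hR)
    ((f.trans (cornerPartCongr (s.isIdempotentElem hR) g)).trans f'.symm)

end IdemSection

open IdemSection in
/-- Every simple module has the form `Hd(A e' ⊗ Inf(T))`, where the section can be chosen from
a given set of representatives. -/
theorem IsClosed.exists_headModule_equiv (hC : C.IsClosed) {𝒮 : Set C.IdemSection}
    (h𝒮 : ∀ s : C.IdemSection, ∃ t ∈ 𝒮, s.Iso t) (M : Type u) [AddCommGroup M]
    [Module (TwistedAlgebra hR) M] [IsSimpleModule (TwistedAlgebra hR) M] :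
    ∃ (s : 𝒮) (T : ModuleCat.{u} (MonoidAlgebra R s.1.autGroup)),
      IsSimpleModule (MonoidAlgebra R s.1.autGroup) T ∧
      ∀ T' : ModuleCat.{u} (MonoidAlgebra R s.1.autGroup),
        Nonempty (T ≃ₗ[MonoidAlgebra R s.1.autGroup] T') →
          Nonempty (s.1.headModule hR T' ≃ₗ[TwistedAlgebra hR] M) := by
  have := IsSimpleModule.nontrivial (TwistedAlgebra hR) M
  -- Among the sections whose idempotent does not annihilate `M`, one with `|P / K|` minimal is
  -- chosen. Its representative `t` has a quotient of the same order and also acts nontrivially.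
  obtain ⟨s, hs, hmin⟩ := WellFounded.has_min
    (InvImage.wf (fun s : C.IdemSection => Nat.card s.sec.quot) Nat.lt_wfRel.wf)
    {s | ∃ x : M, s.idemElt hR • x ≠ 0} (hC.exists_idemElt_smul_ne_zero hR M)
  obtain ⟨t, ht, hst⟩ := h𝒮 s
  have hcard : Nat.card s.sec.quot = Nat.card t.sec.quot := by
    obtain ⟨φ⟩ := hst
    exact Nat.card_congr φ.toEquiv
  obtain ⟨x, hx⟩ := hst.exists_smul_ne_zero hR hC hs
  have hJ : ∀ L : t.obj ⟶ t.obj, t.idemMor ≫ L ≫ t.idemMor = L → (∀ α, L ≠ t.autMor α) →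
      ∀ x : M, of (kappa hR) ⟨t.obj, t.obj, L⟩ • x = 0 := by
    intro L hL hα x
    by_contra hx
    -- A morphism in `J_e` acting nontrivially would make the idempotent of its left section act
    -- nontrivially, against minimality.
    refine hmin _ (hC.leftIdemSection_smul_ne_zero hR M L hx) ?_
    change Nat.card (leftSection L.1).quot < Nat.card s.sec.quot
    rw [hcard]
    exact (t.card_lt_or_exists_autMor hL).resolve_right fun ⟨α, h⟩ => hα α h
  have he := t.isIdempotentElem hR
  have hW := isSimpleModule_cornerPart he hx
  obtain ⟨T, ⟨f⟩⟩ := exists_restrictScalars_equiv (t.proj hR) (t.proj_surjective hR)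
    (cornerPart he M) fun b hb w =>
      Subtype.ext (t.smul_eq_zero_of_proj_eq_zero hR hJ b hb w.1)
  have hT : IsSimpleModule (MonoidAlgebra R t.autGroup) T :=
    (isSimpleModule_restrictScalars_iff _ (t.proj_surjective hR) T).mp
      (IsSimpleModule.congr f.symm)
  -- `T` is constructed from `e' M` and need not be a chosen representative, so the conclusion is
  -- proved for every `T'` isomorphic to it.
  refine ⟨⟨t, ht⟩, T, hT, fun T' ⟨g⟩ => ?_⟩
  have hT' : IsSimpleModule (MonoidAlgebra R t.autGroup) T' := IsSimpleModule.congr g.symm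
  have := t.isSimpleModule_inflation hR T'
  let g' : (t.inflation hR T) ≃ₗ[t.cornerRing hR] (t.inflation hR T') :=
    { g.toAddEquiv with map_smul' := fun b x => g.map_smul (t.proj hR b) x }
  exact nonempty_head_equiv he (W := t.inflation hR T') (g'.symm.trans f.symm)

end BisetSubcategory

end BisetAlg

/-! ### The classification of the simple modules. -/

theorem mainTheorem6 {ι : Type u} {𝒢 : ι → Type u} [∀ i, Group (𝒢 i)] [∀ i, Finite (𝒢 i)]
    (C : BisetAlg.BisetSubcategory 𝒢) [Finite (BisetAlg.Mor C.Obj)] (hC : C.IsClosed)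
    {R : Type u} [CommRing R] (hR : C.OrdersInvertible R)
    (𝒮 : Set C.IdemSection) (h𝒮 : ∀ s : C.IdemSection, ∃! t, t ∈ 𝒮 ∧ s.Iso t)
    (𝒯 : ∀ s : 𝒮, Set (ModuleCat.{u} (MonoidAlgebra R s.1.autGroup)))
    (h𝒯 : ∀ s : 𝒮,
      BisetAlg.IsSimpleRepresentatives (MonoidAlgebra R s.1.autGroup) (𝒯 s)) :
    ∃ h : ∀ (s : 𝒮) (T : 𝒯 s),
        IsSimpleModule (BisetAlg.BisetSubcategory.TwistedAlgebra hR) (s.1.headModule hR T.1),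
      Function.Bijective (fun p : (Σ s : 𝒮, 𝒯 s) =>
        (Quotient.mk _ ⟨p.1.1.headModule hR p.2.1, h p.1 p.2⟩ :
          BisetAlg.SimpleClasses.{u, u} (BisetAlg.BisetSubcategory.TwistedAlgebra hR))) := by
  have key : ∀ M : ModuleCat.{u} (BisetAlg.BisetSubcategory.TwistedAlgebra hR),
      IsSimpleModule (BisetAlg.BisetSubcategory.TwistedAlgebra hR) M →
      ∃ p : Σ s : 𝒮, 𝒯 s, Nonempty (p.1.1.headModule hR p.2.1
        ≃ₗ[BisetAlg.BisetSubcategory.TwistedAlgebra hR] M) := by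
    intro M hM
    have hhead := hC.exists_headModule_equiv hR (fun s => (h𝒮 s).exists) M
    obtain ⟨s, T, hT, h⟩ := hhead
    have hrep := ((h𝒯 s).2 T hT).exists
    obtain ⟨T', hT', g⟩ := hrep
    exact ⟨⟨s, ⟨T', hT'⟩⟩, h T' g⟩
  refine ⟨fun s T => ?_, ?_, ?_⟩
  · have := (h𝒯 s).1 T.1 T.2
    exact s.1.isSimpleModule_headModule hR T.1
  · rintro ⟨s, T⟩ ⟨t, T'⟩ h
    obtain ⟨g⟩ := Quotient.exact h
    have hT := (h𝒯 s).1 T.1 T.2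
    have hT' := (h𝒯 t).1 T'.1 T'.2
    have hst : s.1.Iso t.1 := s.1.iso_of_headModule_equiv hR t.1 T.1 T'.1 g
    -- Both `s` and `t` represent the class of `s`, so they coincide; only then are `T` and `T'`
    -- modules over the same group algebra.
    obtain rfl : s = t :=
      Subtype.ext ((h𝒮 s.1).unique ⟨s.2, ⟨MulEquiv.refl _⟩⟩ ⟨t.2, hst⟩)
    obtain rfl : T = T' := Subtype.ext (((h𝒯 s).2 T.1 hT).unique
      ⟨T.2, ⟨LinearEquiv.refl _ _⟩⟩
      ⟨T'.2, s.1.nonempty_equiv_of_headModule_equiv hR T.1 T'.1 g⟩)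
    rfl
  · exact Quotient.ind fun M => (key M.1 M.2).imp fun p hp => Quotient.sound hp
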